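/- Let $\Sigma$ be a finite multi-sorted first-order signature (with equality) whose symbols are unary function symbols, relation symbols of arbitrary finite (sorted) arities, and possibly individual constants. In every $\Sigma$-structure each sort is interpreted by a non-empty set. Let $G(\Sigma)$ be the directed graph whose nodes are the sorts of $\Sigma$, with an edge $S\to S'$ for each function symbol with source sort $S$ and target sort $S'$; call $\Sigma$ acyclic if $G(\Sigma)$ has no directed cycle (in particular no loop). Let $T$ be a DB theory over $\Sigma$, i.e. a set of universal $\Sigma$-sentences. Suppose that $\Sigma$ is acyclic and that $T$ is axiomatized by finitely many universal one-variable sentences, i.e. $T$ has the same models as some finite set of sentences $\forall x\,\psi(x)$, each with $\psi$ quantifier-free and containing no variable other than $x$. Then: 1. The constraint satisfiability problem for $T$ is decidable: there is an algorithm which, given a constraint (a finite conjunction of literals) or, more generally, a quantifier-free formula $\varphi(\underline x)$, decides whether there are a model $\mathcal M$ of $T$ and an assignment to $\underline x$ in $\mathcal M$ under which $\varphi$ is true. 2. $T$ admits a model completion: there is a set $T^*\supseteq T$ of $\Sigma$-sentences such that (i) every constraint that is satisfiable in a model of $T$ is satisfiable in a model of $T^*$; and (ii) $T^*$ has effective quantifier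 elimination: there is an algorithm which, given a $\Sigma$-formula $\varphi(\underline x)$, computes a quantifier-free formula $\varphi'(\underline x)$, all of whose free variables are free in $\varphi$, such that $T^*\models\varphi(\underline x)\leftrightarrow\varphi'(\underline x)$. (The propositional constant $\bot$ counts as a quantifier-free formula.) -/

import Mathlib

/-- A DB signature: a finite multi-sorted first-order signature whose function symbols are all
unary.  Relation symbols have arbitrary finite sorted arity and there may be individual constants
(such as `undef`); a signature without constants is the case where `Cst` is empty.
The `Primcodable` fields are an arbitrary numbering of the finitely many symbols; they are used
only to give Gödel numbers to formulas. -/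
structure DBSignature where
  Srt : Type
  Cst : Type
  Fn : Type
  Rl : Type
  [finiteSrt : Finite Srt]
  [finiteCst : Finite Cst]
  [finiteFn : Finite Fn]
  [finiteRl : Finite Rl]
  [codeSrt : Primcodable Srt]
  [codeCst : Primcodable Cst]
  [codeFn : Primcodable Fn]
  [codeRl : Primcodable Rl]
  /-- the sort of a constant -/
  cstSort : Cst → Srt
  /-- the source sort of a unary function symbol -/
  dom : Fn → Srt
  /-- the target sort of a unary function symbol -/
  cod : Fn → Srt
  /-- the arity of a relation symbol -/
  arity : Rl → ℕ
  /-- the sorts of the argument places of a relation symbol -/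
  relSort : (r : Rl) → Fin (arity r) → Srt

namespace DBSignature

attribute [instance] finiteSrt finiteCst finiteFn finiteRl codeSrt codeCst codeFn codeRl

/-- There is an edge `s ⟶ s'` in the sort graph iff some function symbol has source `s` and
target `s'`. -/
def Edge (L : DBSignature) (s s' : L.Srt) : Prop :=
  ∃ f : L.Fn, L.dom f = s ∧ L.cod f = s'

/-- The sort graph has no directed cycle (in particular no loop). -/
def Acyclic (L : DBSignature) : Prop :=
  ∀ s : L.Srt, ¬ Relation.TransGen L.Edge s s

/-- Well-sorted terms; every sort `s` has the variables `var s 0, var s 1, …`. -/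
inductive Term (L : DBSignature) : L.Srt → Type
  | var (s : L.Srt) (n : ℕ) : Term L s
  | cst (c : L.Cst) : Term L (L.cstSort c)
  | app (f : L.Fn) (t : Term L (L.dom f)) : Term L (L.cod f)

/-- Well-sorted first-order formulas with equality. -/
inductive Formula (L : DBSignature) : Type
  | falsum : Formula L
  | equal {s : L.Srt} (t u : Term L s) : Formula L
  | rel (r : L.Rl) (ts : (i : Fin (L.arity r)) → Term L (L.relSort r i)) : Formula L
  | imp (φ ψ : Formula L) : Formula L
  | all (s : L.Srt) (n : ℕ) (φ : Formula L) : Formula L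

variable {L : DBSignature}

/-- The variables occurring in a term. -/
def Term.vars : {s : L.Srt} → Term L s → Set (L.Srt × ℕ)
  | _, .var s n => {(s, n)}
  | _, .cst _ => ∅
  | _, .app _ t => t.vars

/-- A Gödel numbering of terms. -/
def Term.code : {s : L.Srt} → Term L s → ℕ
  | _, .var s n => Nat.pair 0 (Nat.pair (Encodable.encode s) n)
  | _, .cst c => Nat.pair 1 (Encodable.encode c)
  | _, .app f t => Nat.pair 2 (Nat.pair (Encodable.encode f) t.code)

namespace Formula

def neg (φ : Formula L) : Formula L := φ.imp falsum

def top : Formula L := neg falsum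

def and (φ ψ : Formula L) : Formula L := neg (φ.imp ψ.neg)

/-- The conjunction of a finite list of formulas. -/
def conj (l : List (Formula L)) : Formula L := l.foldr and top

def freeVars : Formula L → Set (L.Srt × ℕ)
  | falsum => ∅
  | equal t u => t.vars ∪ u.vars
  | rel _ ts => ⋃ i, (ts i).vars
  | imp φ ψ => φ.freeVars ∪ ψ.freeVars
  | all s n φ => φ.freeVars \ {(s, n)}

/-- A Gödel numbering of formulas. -/
def code : Formula L → ℕ
  | falsum => Nat.pair 0 0
  | equal t u => Nat.pair 1 (Nat.pair t.code u.code)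
  | rel r ts =>
      Nat.pair 2 (Nat.pair (Encodable.encode r) (Encodable.encode (List.ofFn fun i => (ts i).code)))
  | imp φ ψ => Nat.pair 3 (Nat.pair φ.code ψ.code)
  | all s n φ => Nat.pair 4 (Nat.pair (Nat.pair (Encodable.encode s) n) φ.code)

/-- Quantifier-free formulas. -/
def IsQF : Formula L → Prop
  | falsum => True
  | equal _ _ => True
  | rel _ _ => True
  | imp φ ψ => φ.IsQF ∧ ψ.IsQF
  | all _ _ _ => False

inductive IsAtomic : Formula L → Prop
  | equal {s : L.Srt} (t u : Term L s) : IsAtomic (.equal t u)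
  | rel (r : L.Rl) (ts : (i : Fin (L.arity r)) → Term L (L.relSort r i)) : IsAtomic (.rel r ts)

/-- Literals are atomic formulas and negations of atomic formulas. -/
def IsLiteral (φ : Formula L) : Prop :=
  φ.IsAtomic ∨ ∃ ψ : Formula L, ψ.IsAtomic ∧ φ = ψ.neg

/-- Constraints are finite conjunctions of literals. -/
def IsConstraint (φ : Formula L) : Prop :=
  ∃ l : List (Formula L), (∀ ψ ∈ l, ψ.IsLiteral) ∧ φ = conj l

/-- Universal formulas `∀ x₁ … ∀ xₖ, ψ` with `ψ` quantifier-free. -/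
inductive IsUniversal : Formula L → Prop
  | qf {φ : Formula L} (h : φ.IsQF) : IsUniversal φ
  | all (s : L.Srt) (n : ℕ) {φ : Formula L} (h : IsUniversal φ) : IsUniversal (.all s n φ)

/-- Universal one-variable formulas `∀ x, ψ(x)`: here `ψ` is quantifier-free and has no
variable other than `x`. -/
def IsUniversalOneVar (φ : Formula L) : Prop :=
  ∃ (s : L.Srt) (n : ℕ) (ψ : Formula L), ψ.IsQF ∧ ψ.freeVars ⊆ {(s, n)} ∧ φ = .all s n ψ

end Formula

/-- Multi-sorted structures; as usual in first-order logic every sort is non-empty. -/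
structure Struct (L : DBSignature) where
  carrier : L.Srt → Type
  nonempty : ∀ s, Nonempty (carrier s)
  cst : (c : L.Cst) → carrier (L.cstSort c)
  fn : (f : L.Fn) → carrier (L.dom f) → carrier (L.cod f)
  rel : (r : L.Rl) → ((i : Fin (L.arity r)) → carrier (L.relSort r i)) → Prop

/-- Assignments of elements to the variables of each sort. -/
abbrev Assignment (M : Struct L) : Type := (s : L.Srt) → ℕ → M.carrier s

open Classical in
/-- Change the value of the variable `var s n` to `a`. -/
noncomputable def Assignment.update {M : Struct L} (v : Assignment M) (s : L.Srt) (n : ℕ)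
    (a : M.carrier s) : Assignment M :=
  Function.update v s (Function.update (v s) n a)

def Term.eval (M : Struct L) (v : Assignment M) : {s : L.Srt} → Term L s → M.carrier s
  | _, .var s n => v s n
  | _, .cst c => M.cst c
  | _, .app f t => M.fn f (t.eval M v)

/-- Tarskian truth of a formula in a structure under an assignment. -/
def Formula.Realize (M : Struct L) : Assignment M → Formula L → Prop
  | _, .falsum => False
  | v, .equal t u => t.eval M v = u.eval M v
  | v, .rel r ts => M.rel r fun i => (ts i).eval M v
  | v, .imp φ ψ => φ.Realize M v → ψ.Realize M v
  | v, .all s n φ => ∀ a : M.carrier s, φ.Realize M (v.update s n a)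

/-- Sentences are formulas without free variables. -/
def Sentence (L : DBSignature) : Type := {φ : Formula L // φ.freeVars = ∅}

/-- A theory is a set of sentences. -/
abbrev Theory (L : DBSignature) : Type := Set (Sentence L)

namespace Theory

/-- `M` is a model of `T`. -/
def IsModel (T : Theory L) (M : Struct L) : Prop :=
  ∀ φ ∈ T, ∀ v : Assignment M, φ.1.Realize M v

/-- `φ` is true in some model of `T` under some assignment to its free variables. -/
def Satisfiable (T : Theory L) (φ : Formula L) : Prop :=
  ∃ (M : Struct L) (v : Assignment M), T.IsModel M ∧ φ.Realize M v

/-- `T ⊨ φ ↔ ψ`: in all models of `T` and under all assignments `φ` and `ψ` are equivalent. -/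
def Equivalent (T : Theory L) (φ ψ : Formula L) : Prop :=
  ∀ (M : Struct L) (v : Assignment M), T.IsModel M → (φ.Realize M v ↔ ψ.Realize M v)

/-- DB theories are sets of universal sentences. -/
def IsDBTheory (T : Theory L) : Prop :=
  ∀ φ ∈ T, φ.1.IsUniversal

/-- `T` has the same models as some finite set of universal one-variable sentences. -/
def IsFinitelyOneVarAxiomatized (T : Theory L) : Prop :=
  ∃ Φ : Theory L, Φ.Finite ∧ (∀ φ ∈ Φ, φ.1.IsUniversalOneVar) ∧
    ∀ M : Struct L, T.IsModel M ↔ Φ.IsModel M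

/-- The constraint satisfiability problem for `T` is decidable: some computable function decides,
given the Gödel number of a constraint or, more generally, of any quantifier-free formula `φ`,
whether `φ` is satisfiable in a model of `T`. -/
def DecidableConstraintSat (T : Theory L) : Prop :=
  ∃ f : ℕ → Bool, Computable f ∧
    ∀ φ : Formula L, φ.IsQF → (f φ.code = true ↔ T.Satisfiable φ)

/-- `T` eliminates quantifiers effectively: some computable function maps (the Gödel number of)
each formula `φ` to (the Gödel number of) a quantifier-free formula which is equivalent to `φ`
modulo `T` and has no free variables other than those of `φ`. -/
def EliminatesQuantifiers (T : Theory L) : Prop :=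
  ∃ q : ℕ → ℕ, Computable q ∧
    ∀ φ : Formula L, ∃ ψ : Formula L, ψ.code = q φ.code ∧ ψ.IsQF ∧ ψ.freeVars ⊆ φ.freeVars ∧
      T.Equivalent φ ψ

/-- `T'` is a model completion of `T`: it contains `T`, every constraint that is satisfiable in a
model of `T` is satisfiable in a model of `T'`, and `T'` eliminates quantifiers. -/
def IsModelCompletion (T T' : Theory L) : Prop :=
  T ⊆ T' ∧ (∀ φ : Formula L, φ.IsConstraint → T.Satisfiable φ → T'.Satisfiable φ) ∧
    T'.EliminatesQuantifiers

end Theory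

/-- Different terms have different Gödel numbers. -/
theorem Term.code_injective {s s' : L.Srt} (t : Term L s) (u : Term L s')
    (h : t.code = u.code) : s = s' ∧ HEq t u := by
  induction t generalizing s' with
  | var s n =>
    cases u <;> simp [Term.code, Nat.pair_eq_pair] at h
    obtain ⟨rfl, rfl⟩ := h
    exact ⟨rfl, HEq.rfl⟩
  | cst c =>
    cases u <;> simp [Term.code, Nat.pair_eq_pair] at h
    subst h
    exact ⟨rfl, HEq.rfl⟩
  | app f t ih =>
    cases u <;> simp [Term.code, Nat.pair_eq_pair] at h
    obtain ⟨rfl, h⟩ := h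
    obtain ⟨-, h⟩ := ih _ h
    cases h
    exact ⟨rfl, HEq.rfl⟩

/-- Different formulas have different Gödel numbers. -/
theorem Formula.code_injective : Function.Injective (Formula.code (L := L)) := by
  intro φ
  induction φ with
  | falsum => intro ψ h; cases ψ <;> simp [Formula.code, Nat.pair_eq_pair] at h; rfl
  | equal t u =>
    intro ψ h
    cases ψ <;> simp [Formula.code, Nat.pair_eq_pair] at h
    obtain ⟨rfl, h1⟩ := Term.code_injective _ _ h.1
    obtain ⟨-, h2⟩ := Term.code_injective _ _ h.2
    cases h1; cases h2; rfl
  | rel r ts =>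
    intro ψ h
    cases ψ <;> simp [Formula.code, Nat.pair_eq_pair] at h
    obtain ⟨rfl, h⟩ := h
    have h := List.ofFn_injective h
    congr 1
    funext i
    exact eq_of_heq (Term.code_injective _ _ (congrFun h i)).2
  | imp φ ψ ih1 ih2 =>
    intro χ h
    cases χ <;> simp [Formula.code, Nat.pair_eq_pair] at h
    rw [ih1 h.1, ih2 h.2]
  | all s n φ ih =>
    intro χ h
    cases χ <;> simp [Formula.code, Nat.pair_eq_pair] at h
    obtain ⟨⟨rfl, rfl⟩, h⟩ := h
    rw [ih h]

end DBSignature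

/-!
The proof rests on the free amalgam of structures. As all function symbols are unary, two structures
with a common substructure have an amalgam in which every element, together with the values of all
terms at it, lies in one of the two pieces; a universal sentence with a single variable therefore
passes from the pieces to the amalgam (`isModel_of_locally`, `amalgam_isModel`) and to unions of
chains (`chainLimit_isModel`). Iterating amalgamation with all possible solutions of quantifier-free
formulas, every model embeds into a *rich* model, in which a quantifier-free formula `χ(a, y)` has
a solution as soon as it has one in some model containing a copy of the substructure generated
by `a` (`exists_emb_isRich`). The model completion is the theory of all rich models.

Acyclicity makes the set of terms over finitely many variables finite, with a primitive recursive
bound on their Gödel numbers (`exists_term_bound`). Hence the atomic formulas over the variables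
below `N` which are true in a structure are recorded by the bits of a natural number. Such a
number comes from a model exactly if it respects the axioms of equality and the instances of the
finitely many one-variable axioms (`Agrees.admissible`, `Admissible.exists_agrees`: the converse is
a Herbrand structure of terms), and this is a primitive recursive condition
(`primrec_admissible`). Satisfiability of a quantifier-free formula is thus a bounded search.

In a rich model, `∀ x, χ` holds at `a` iff every admissible valuation with the same values as
the one of `a` on the atomic formulas without `x` makes `χ` true. This is a condition on finitely
many atomic formulas, so some quantifier-free formula expresses it; since correctness of a candidate
is decidable (`IsElimination`), it is found by unbounded search, and recursion on Gödel
numbers (`codeRec`) extends the elimination to all formulas.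
-/

open Filter

/-! ### Primitive recursive predicates -/

attribute [fun_prop] Primrec PrimrecPred
attribute [fun_prop] Primrec.id Primrec.const Primrec.comp Primrec.pair Primrec.fst Primrec.snd
attribute [fun_prop] PrimrecPred.and PrimrecPred.or PrimrecPred.not
attribute [fun_prop] Primrec.ite PrimrecPred.decide

section Primrec

variable {α β σ : Type} [Primcodable α] [Primcodable β] [Primcodable σ]

@[fun_prop] theorem Primrec.natPair_comp {f g : α → ℕ} (hf : Primrec f) (hg : Primrec g) :
    Primrec fun a => Nat.pair (f a) (g a) := Primrec₂.natPair.comp hf hg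

@[fun_prop] theorem Primrec.natUnpair_comp {f : α → ℕ} (hf : Primrec f) :
    Primrec fun a => Nat.unpair (f a) := Primrec.unpair.comp hf

@[fun_prop] theorem Primrec.natAdd_comp {f g : α → ℕ} (hf : Primrec f) (hg : Primrec g) :
    Primrec fun a => f a + g a := Primrec.nat_add.comp hf hg

@[fun_prop] theorem Primrec.natPow_comp {f g : α → ℕ} (hf : Primrec f) (hg : Primrec g) :
    Primrec fun a => f a ^ g a := (Primrec₂.unpaired'.1 Nat.Primrec.pow).comp hf hg

@[fun_prop] theorem Primrec.natTestBit_comp {f g : α → ℕ} (hf : Primrec f) (hg : Primrec g) :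
    Primrec fun a => (f a).testBit (g a) := by
  have h : PrimrecPred fun a => f a / 2 ^ g a % 2 = 1 :=
    Primrec.eq.comp (Primrec.nat_mod.comp (Primrec.nat_div.comp hf
      (natPow_comp (.const 2) hg)) (.const 2)) (.const 1)
  exact h.decide.of_eq fun a => (Nat.testBit_eq_decide_div_mod_eq).symm

@[fun_prop] theorem Primrec.range_comp {f : α → ℕ} (hf : Primrec f) :
    Primrec fun a => List.range (f a) := Primrec.list_range.comp hf

@[fun_prop] theorem Primrec.boolAnd_comp {f g : α → Bool} (hf : Primrec f) (hg : Primrec g) :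
    Primrec fun a => (f a && g a) := Primrec.and.comp hf hg

@[fun_prop] theorem Primrec.boolOr_comp {f g : α → Bool} (hf : Primrec f) (hg : Primrec g) :
    Primrec fun a => (f a || g a) := Primrec.or.comp hf hg

@[fun_prop] theorem Primrec.boolNot_comp {f : α → Bool} (hf : Primrec f) :
    Primrec fun a => !f a := Primrec.not.comp hf

@[fun_prop] theorem PrimrecPred.eq_comp {f g : α → σ} (hf : Primrec f) (hg : Primrec g) :
    PrimrecPred fun a => f a = g a := by
  classical exact Primrec.eq.comp hf hg

@[fun_prop] theorem PrimrecPred.lt_comp {f g : α → ℕ} (hf : Primrec f) (hg : Primrec g) :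
    PrimrecPred fun a => f a < g a := Primrec.nat_lt.comp hf hg

@[fun_prop] theorem PrimrecPred.imp {p q : α → Prop} (hp : PrimrecPred p) (hq : PrimrecPred q) :
    PrimrecPred fun a => p a → q a :=
  (hp.not.or hq).of_eq fun _ => imp_iff_not_or.symm

@[fun_prop] theorem PrimrecPred.iff {p q : α → Prop} (hp : PrimrecPred p) (hq : PrimrecPred q) :
    PrimrecPred fun a => p a ↔ q a :=
  ((hp.imp hq).and (hq.imp hp)).of_eq fun _ => iff_iff_implies_and_implies.symm

@[fun_prop] theorem PrimrecPred.forall_lt_comp {f : α → ℕ} {p : α → ℕ → Prop} (hf : Primrec f)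
    (hp : PrimrecPred fun x : α × ℕ => p x.1 x.2) : PrimrecPred fun a => ∀ i < f a, p a i := by
  have h : PrimrecRel fun (i : ℕ) a => p a i := hp.comp (Primrec.snd.pair Primrec.fst)
  exact (h.forall_mem_list.comp (Primrec.list_range.comp hf) Primrec.id).of_eq (by simp)

@[fun_prop] theorem PrimrecPred.exists_lt_comp {f : α → ℕ} {p : α → ℕ → Prop} (hf : Primrec f)
    (hp : PrimrecPred fun x : α × ℕ => p x.1 x.2) : PrimrecPred fun a => ∃ i < f a, p a i :=
  (PrimrecPred.forall_lt_comp (p := fun a i => ¬ p a i) hf hp.not).not.of_eq (by simp)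

@[fun_prop] theorem PrimrecPred.mem_comp {f : α → σ} {l : α → List σ} (hf : Primrec f)
    (hl : Primrec l) : PrimrecPred fun a => f a ∈ l a := by
  have h : PrimrecRel fun (x : σ) y => x = y := PrimrecPred.eq_comp Primrec.fst Primrec.snd
  exact (h.exists_mem_list.comp hl hf).of_eq (by simp)

theorem Primrec.filter_comp {p : α → β → Prop} [∀ a, DecidablePred (p a)] {l : α → List β}
    (hl : Primrec l) (hp : PrimrecPred fun x : α × β => p x.1 x.2) :
    Primrec fun a => (l a).filter (p a ·) := by
  classical
  have h : PrimrecRel fun (b : β) a => p a b := hp.comp (Primrec.snd.pair Primrec.fst)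
  exact (h.listFilter.comp hl Primrec.id).of_eq fun a => by congr

theorem PrimrecPred.forall_finite {ι : Type} [Finite ι] {p : ι → α → Prop}
    (h : ∀ i, PrimrecPred (p i)) : PrimrecPred fun a => ∀ i, p i a := by
  have key : ∀ l : List ι, PrimrecPred fun a => ∀ i ∈ l, p i a := by
    intro l
    induction l with
    | nil => exact (PrimrecPred.eq_comp (.const 0) (.const 0)).of_eq (by simp)
    | cons i l ih => exact ((h i).and ih).of_eq (by simp)
  cases nonempty_fintype ι
  exact (key Finset.univ.toList).of_eq (by simp)

/-- Finitely many bounds have a common bound. -/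
theorem Primrec.exists_bound_of_finite {ι : Type} [Finite ι] {f : ι → ℕ → ℕ}
    (hf : ∀ i, Primrec (f i)) : ∃ g : ℕ → ℕ, Primrec g ∧ ∀ i n, f i n ≤ g n := by
  have key : ∀ l : List ι, ∃ g : ℕ → ℕ, Primrec g ∧ ∀ i ∈ l, ∀ n, f i n ≤ g n := by
    intro l
    induction l with
    | nil => exact ⟨id, Primrec.id, by simp⟩
    | cons i l ih =>
      obtain ⟨g, hg, h⟩ := ih
      refine ⟨fun n => f i n + g n, by have := hf i; fun_prop, fun j hj n => ?_⟩
      rcases List.mem_cons.1 hj with rfl | hj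
      · exact Nat.le_add_right _ _
      · exact (h j hj n).trans (Nat.le_add_left _ _)
  cases nonempty_fintype ι
  obtain ⟨g, hg, h⟩ := key Finset.univ.toList
  exact ⟨g, hg, fun i => h i (by simp)⟩

@[fun_prop] theorem Primrec.decode₂_comp {f : α → ℕ} (hf : Primrec f) :
    Primrec fun a => Encodable.decode₂ β (f a) := Primrec.decode₂.comp hf

/-- Unbounded search for a solution which is known to exist. -/
theorem PrimrecPred.exists_computable {p : α → ℕ → Prop}
    (hp : PrimrecPred fun x : α × ℕ => p x.1 x.2) (h : ∀ a, ∃ n, p a n) :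
    ∃ f : α → ℕ, Computable f ∧ ∀ a, p a (f a) := by
  classical
  have hd : Computable₂ fun a n => decide (p a n) := hp.decide.to_comp
  refine ⟨fun a => Nat.find (h a), ?_, fun a => Nat.find_spec (h a)⟩
  refine (Partrec.rfind hd.partrec₂).of_eq_tot fun a => ?_
  simp only [Nat.mem_rfind, Part.mem_some_iff, PFun.coe_val, true_eq_decide_iff,
    false_eq_decide_iff]
  exact ⟨Nat.find_spec (h a), fun hm => Nat.find_min (h a) hm⟩

theorem unpair_right_lt {n : ℕ} (h : n.unpair.1 ≠ 0) : n.unpair.2 < n := by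
  have := Nat.add_le_pair n.unpair.1 n.unpair.2
  rw [Nat.pair_unpair] at this
  omega

/-- Recursion on Gödel numbers `⟨tag, ⟨m₀, m₁⟩⟩`: numbers with tag `0` have values given by `b`, the
value of any other number is computed by `g` from the number and the values of `m₀` and `m₁`. -/
def codeRec {σ : Type} (b : ℕ → σ) (g : ℕ → σ → σ → σ) (n : ℕ) : σ :=
  if h : n.unpair.1 = 0 then b n else
    have : n.unpair.2.unpair.1 < n := (Nat.unpair_left_le _).trans_lt (unpair_right_lt h)
    have : n.unpair.2.unpair.2 < n := (Nat.unpair_right_le _).trans_lt (unpair_right_lt h)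
    g n (codeRec b g n.unpair.2.unpair.1) (codeRec b g n.unpair.2.unpair.2)

theorem codeRec_of_tag_zero {σ : Type} (b : ℕ → σ) (g : ℕ → σ → σ → σ) {n : ℕ}
    (h : n.unpair.1 = 0) : codeRec b g n = b n := by
  rw [codeRec, dif_pos h]

theorem codeRec_of_tag_ne_zero {σ : Type} (b : ℕ → σ) (g : ℕ → σ → σ → σ) {n : ℕ}
    (h : n.unpair.1 ≠ 0) : codeRec b g n =
      g n (codeRec b g n.unpair.2.unpair.1) (codeRec b g n.unpair.2.unpair.2) := by
  rw [codeRec, dif_neg h]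

/-- The step of course-of-values recursion for `codeRec`, on the list of previous values. -/
def codeRecStep {σ : Type} (b : ℕ → σ) (g : ℕ → σ → σ → σ) (l : List σ) : Option σ :=
  if l.length.unpair.1 = 0 then some (b l.length) else
    l[l.length.unpair.2.unpair.1]?.bind fun x =>
      l[l.length.unpair.2.unpair.2]?.map fun y => g l.length x y

theorem codeRecStep_map_range {σ : Type} (b : ℕ → σ) (g : ℕ → σ → σ → σ) (n : ℕ) :
    codeRecStep b g ((List.range n).map (codeRec b g)) = some (codeRec b g n) := by
  by_cases h : n.unpair.1 = 0
  · simp [codeRecStep, h, codeRec_of_tag_zero]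
  · have h1 : n.unpair.2.unpair.1 < n := (Nat.unpair_left_le _).trans_lt (unpair_right_lt h)
    have h2 : n.unpair.2.unpair.2 < n := (Nat.unpair_right_le _).trans_lt (unpair_right_lt h)
    simp [codeRecStep, h, codeRec_of_tag_ne_zero, h1, h2]

theorem primrec_codeRec {b : α → ℕ → σ} {g : α → ℕ → σ → σ → σ}
    (hb : Primrec fun x : α × ℕ => b x.1 x.2)
    (hg : Primrec fun x : α × ℕ × σ × σ => g x.1 x.2.1 x.2.2.1 x.2.2.2) :
    Primrec₂ fun a n => codeRec (b a) (g a) n := by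
  refine Primrec.nat_strong_rec _ (g := fun a l => codeRecStep (b a) (g a) l) ?_
    fun a n => codeRecStep_map_range _ _ n
  have hl : Primrec fun x : α × List σ => x.2.length := Primrec.list_length.comp Primrec.snd
  have hu : Primrec fun x : α × List σ => x.2.length.unpair.2.unpair := by fun_prop
  have hz : PrimrecPred fun x : α × List σ => x.2.length.unpair.1 = 0 := by fun_prop
  unfold Primrec₂ codeRecStep
  refine Primrec.ite hz (Primrec.option_some.comp (hb.comp (Primrec.fst.pair hl))) ?_
  refine Primrec.option_bind (Primrec.list_getElem?.comp Primrec.snd (Primrec.fst.comp hu)) ?_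
  refine Primrec.option_map (Primrec.list_getElem?.comp (Primrec.snd.comp Primrec.fst)
    (Primrec.snd.comp (hu.comp Primrec.fst))) ?_
  exact hg.comp ((Primrec.fst.comp (Primrec.fst.comp Primrec.fst)).pair
    ((hl.comp (Primrec.fst.comp Primrec.fst)).pair
      ((Primrec.snd.comp Primrec.fst).pair Primrec.snd)))

theorem computable_codeRecStep {b : ℕ → σ} {g : ℕ → σ → σ → σ} (hb : Computable b)
    (hg : Computable fun x : ℕ × σ × σ => g x.1 x.2.1 x.2.2) : Computable (codeRecStep b g) := by
  have hl : Computable fun l : List σ => l.length := Computable.list_length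
  have hu : Computable fun l : List σ => l.length.unpair.2.unpair :=
    Computable.unpair.comp (Computable.snd.comp (Computable.unpair.comp hl))
  have hp : PrimrecPred fun n : ℕ => n.unpair.1 = 0 := by fun_prop
  have hz : Computable fun l : List σ => decide (l.length.unpair.1 = 0) :=
    hp.decide.to_comp.comp hl
  have h1 : Computable fun l : List σ => l[l.length.unpair.2.unpair.1]? :=
    Computable.list_getElem?.comp Computable.id (Computable.fst.comp hu)
  have h2 : Computable fun l : List σ => l[l.length.unpair.2.unpair.2]? :=
    Computable.list_getElem?.comp Computable.id (Computable.snd.comp hu)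
  have h3 : Computable₂ fun (x : List σ × σ) (y : σ) => g x.1.length x.2 y :=
    hg.comp ((hl.comp (Computable.fst.comp Computable.fst)).pair
      ((Computable.snd.comp Computable.fst).pair Computable.snd))
  have h4 : Computable₂ fun (l : List σ) (x : σ) =>
      l[l.length.unpair.2.unpair.2]?.map fun y => g l.length x y :=
    Computable.option_map (h2.comp Computable.fst) h3
  have h5 : Computable fun l : List σ => bif decide (l.length.unpair.1 = 0)
      then some (b l.length) else l[l.length.unpair.2.unpair.1]?.bind fun x =>
        l[l.length.unpair.2.unpair.2]?.map fun y => g l.length x y :=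
    Computable.cond hz (Computable.option_some.comp (hb.comp hl)) (Computable.option_bind h1 h4)
  exact h5.of_eq fun l => by simp only [codeRecStep, Bool.cond_decide]

/-- The version of `primrec_codeRec` for computable functions. Eliminating a quantifier uses
unbounded search, so recursion through it is not seen to be primitive recursive. -/
theorem computable_codeRec {b : ℕ → σ} {g : ℕ → σ → σ → σ} (hb : Computable b)
    (hg : Computable fun x : ℕ × σ × σ => g x.1 x.2.1 x.2.2) : Computable (codeRec b g) := by
  have h : Computable₂ fun (_ : Unit) n => codeRec b g n :=
    Computable.nat_strong_rec _ (g := fun _ l => codeRecStep b g l)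
      ((computable_codeRecStep hb hg).comp Computable.snd) fun _ n => codeRecStep_map_range _ _ n
  exact h.comp (Computable.const ()) Computable.id

end Primrec

namespace DBSignature

open Encodable

variable {L : DBSignature}

/-! ### Variables and truth -/

theorem Term.eval_congr {M : Struct L} {v w : Assignment M} {s : L.Srt} (t : Term L s)
    (h : ∀ x ∈ t.vars, v x.1 x.2 = w x.1 x.2) : t.eval M v = t.eval M w := by
  induction t with
  | var s n => exact h (s, n) rfl
  | cst c => rfl
  | app f t ih => exact congrArg (M.fn f) (ih h)

@[simp] theorem Assignment.update_same {M : Struct L} (v : Assignment M) (s : L.Srt) (n : ℕ)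
    (a : M.carrier s) : v.update s n a s n = a := by
  simp [Assignment.update]

theorem Assignment.update_of_ne {M : Struct L} (v : Assignment M) (s : L.Srt) (n : ℕ)
    (a : M.carrier s) {s' : L.Srt} {n' : ℕ} (h : (s', n') ≠ (s, n)) :
    v.update s n a s' n' = v s' n' := by
  by_cases hs : s' = s
  · subst hs
    have hn : n' ≠ n := fun hn => h (by rw [hn])
    simp [Assignment.update, hn]
  · simp [Assignment.update, hs]

@[simp] theorem Assignment.update_self {M : Struct L} (v : Assignment M) (s : L.Srt) (n : ℕ) :
    v.update s n (v s n) = v := by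
  simp [Assignment.update]

theorem Assignment.update_congr {M : Struct L} {v w : Assignment M} {s : L.Srt} {n : ℕ}
    {a : M.carrier s} {x : L.Srt × ℕ} (h : x ≠ (s, n) → v x.1 x.2 = w x.1 x.2) :
    v.update s n a x.1 x.2 = w.update s n a x.1 x.2 := by
  by_cases hx : x = (s, n)
  · subst hx; simp
  · rw [Assignment.update_of_ne _ _ _ _ hx, Assignment.update_of_ne _ _ _ _ hx, h hx]

theorem Formula.realize_congr {M : Struct L} {v w : Assignment M} (φ : Formula L)
    (h : ∀ x ∈ φ.freeVars, v x.1 x.2 = w x.1 x.2) : φ.Realize M v ↔ φ.Realize M w := by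
  induction φ generalizing v w with
  | falsum => rfl
  | equal t u =>
    simp only [Formula.Realize]
    rw [t.eval_congr fun x hx => h x (Or.inl hx), u.eval_congr fun x hx => h x (Or.inr hx)]
  | rel r ts =>
    simp only [Formula.Realize]
    rw [funext fun i => (ts i).eval_congr fun x hx => h x (Set.mem_iUnion.2 ⟨i, hx⟩)]
  | imp φ ψ ih1 ih2 =>
    simp only [Formula.Realize]
    rw [ih1 fun x hx => h x (Or.inl hx), ih2 fun x hx => h x (Or.inr hx)]
  | all s n φ ih =>
    refine forall_congr' fun a => ih fun x hx => ?_
    exact Assignment.update_congr fun hne => h x ⟨hx, hne⟩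

theorem Term.vars_finite {s : L.Srt} (t : Term L s) : t.vars.Finite := by
  induction t with
  | var s n => exact Set.finite_singleton _
  | cst c => exact Set.finite_empty
  | app f t ih => exact ih

theorem Formula.freeVars_finite (φ : Formula L) : φ.freeVars.Finite := by
  induction φ with
  | falsum => exact Set.finite_empty
  | equal t u => exact t.vars_finite.union u.vars_finite
  | rel r ts => exact Set.finite_iUnion fun i => (ts i).vars_finite
  | imp φ ψ ih1 ih2 => exact ih1.union ih2
  | all s n φ ih => exact ih.sdiff

/-! ### Embeddings -/

/-- An embedding of structures: injective on every sort, it preserves constants and functions, and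
preserves and reflects relations. -/
structure Emb (M N : Struct L) where
  toFun : ∀ s, M.carrier s → N.carrier s
  inj : ∀ s, Function.Injective (toFun s)
  map_cst : ∀ c, toFun _ (M.cst c) = N.cst c
  map_fn : ∀ f x, toFun _ (M.fn f x) = N.fn f (toFun _ x)
  map_rel : ∀ r (xs : ∀ i, M.carrier (L.relSort r i)),
    N.rel r (fun i => toFun _ (xs i)) ↔ M.rel r xs

namespace Emb

variable {M N : Struct L}

/-- The image of an assignment under an embedding. -/
def assign (e : Emb M N) (v : Assignment M) : Assignment N := fun s n => e.toFun s (v s n)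

theorem eval (e : Emb M N) (v : Assignment M) {s : L.Srt} (t : Term L s) :
    t.eval N (e.assign v) = e.toFun s (t.eval M v) := by
  induction t with
  | var s n => rfl
  | cst c => exact (e.map_cst c).symm
  | app f t ih => simp only [Term.eval, ih, e.map_fn]

theorem realize (e : Emb M N) (v : Assignment M) {φ : Formula L} (hφ : φ.IsQF) :
    φ.Realize N (e.assign v) ↔ φ.Realize M v := by
  induction φ with
  | falsum => rfl
  | equal t u => simp only [Formula.Realize, e.eval, (e.inj _).eq_iff]
  | rel r ts => simp only [Formula.Realize, e.eval]; exact e.map_rel r _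
  | imp φ ψ ih1 ih2 => simp only [Formula.Realize, ih1 hφ.1, ih2 hφ.2]
  | all s n φ ih => exact hφ.elim

end Emb

theorem Struct.exists_assignment (M : Struct L) : Nonempty (Assignment M) :=
  ⟨fun s _ => (M.nonempty s).some⟩

/-- Universal one-variable sentences are local: they hold in a structure as soon as every single
element lies in an embedded structure in which they hold. -/
theorem isModel_of_locally {Φ : Theory L} (hΦ : ∀ φ ∈ Φ, φ.1.IsUniversalOneVar) {M : Struct L}
    (h : ∀ s (a : M.carrier s), ∃ (N : Struct L) (e : Emb N M) (b : N.carrier s),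
      Φ.IsModel N ∧ e.toFun s b = a) : Φ.IsModel M := by
  intro φ hφ v
  obtain ⟨s, n, ψ, hψ, hv, e⟩ := hΦ φ hφ
  rw [e]
  intro a
  obtain ⟨N, e', b, hN, rfl⟩ := h s a
  obtain ⟨w⟩ := N.exists_assignment
  have := hN φ hφ w
  rw [e] at this
  refine (Formula.realize_congr ψ ?_).1 ((e'.realize _ hψ).2 (this b))
  intro x hx
  obtain rfl : x = (s, n) := hv hx
  simp [Emb.assign]

/-! ### Amalgamation -/

/-- An isomorphism between a substructure of `M` and a substructure of `N`, given as a relation. -/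
structure PartialIso (M N : Struct L) where
  R : ∀ s, M.carrier s → N.carrier s → Prop
  eq_iff : ∀ {s x y x' y'}, R s x y → R s x' y' → (x = x' ↔ y = y')
  cst : ∀ c, R _ (M.cst c) (N.cst c)
  fn : ∀ f {x y}, R _ x y → R _ (M.fn f x) (N.fn f y)
  rel : ∀ r {xs ys}, (∀ i, R (L.relSort r i) (xs i) (ys i)) → (M.rel r xs ↔ N.rel r ys)

section Amalgam

variable {ι : Type} {M : Struct L} {N : ι → Struct L} (p : ∀ i, PartialIso M (N i))

open Classical in
/-- The inclusion of `N i` into the amalgam: an element of `N i` which corresponds to an element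
of `M` is identified with it, every other element is new. -/
noncomputable def amalgamIn (i : ι) (s : L.Srt) (y : (N i).carrier s) :
    M.carrier s ⊕ Σ i, {y : (N i).carrier s // ¬ ∃ x, (p i).R s x y} :=
  if h : ∃ x, (p i).R s x y then .inl h.choose else .inr ⟨i, y, h⟩

theorem amalgamIn_of_rel {i : ι} {s : L.Srt} {x : M.carrier s} {y : (N i).carrier s}
    (h : (p i).R s x y) : amalgamIn p i s y = .inl x := by
  have h' : ∃ x, (p i).R s x y := ⟨x, h⟩
  rw [amalgamIn, dif_pos h', ((p i).eq_iff h'.choose_spec h).2 rfl]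

theorem amalgamIn_of_not {i : ι} {s : L.Srt} {y : (N i).carrier s}
    (h : ¬ ∃ x, (p i).R s x y) : amalgamIn p i s y = .inr ⟨i, y, h⟩ := dif_neg h

theorem amalgamIn_eq_inl {i : ι} {s : L.Srt} {x : M.carrier s} {y : (N i).carrier s} :
    amalgamIn p i s y = .inl x ↔ (p i).R s x y := by
  refine ⟨fun h => ?_, amalgamIn_of_rel p⟩
  by_cases h' : ∃ x, (p i).R s x y
  · obtain ⟨x', hx'⟩ := h'
    rw [amalgamIn_of_rel p hx'] at h
    cases h
    exact hx'
  · rw [amalgamIn_of_not p h'] at h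
    cases h

theorem amalgamIn_injective (i : ι) (s : L.Srt) : Function.Injective (amalgamIn p i s) := by
  intro y y' h
  by_cases hy : ∃ x, (p i).R s x y
  · obtain ⟨x, hx⟩ := hy
    rw [amalgamIn_of_rel p hx, eq_comm, amalgamIn_eq_inl] at h
    exact ((p i).eq_iff hx h).1 rfl
  · by_cases hy' : ∃ x, (p i).R s x y'
    · obtain ⟨x, hx⟩ := hy'
      rw [amalgamIn_of_rel p hx, amalgamIn_eq_inl] at h
      exact (hy ⟨x, h⟩).elim
    · rw [amalgamIn_of_not p hy, amalgamIn_of_not p hy'] at h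
      simpa using h

/-- Elements of two different pieces can only be identified inside `M`. -/
theorem exists_rel_of_amalgamIn_eq {i j : ι} (hij : i ≠ j) {s : L.Srt} {y : (N i).carrier s}
    {z : (N j).carrier s} (h : amalgamIn p i s y = amalgamIn p j s z) :
    ∃ x, (p i).R s x y ∧ (p j).R s x z := by
  by_cases hy : ∃ x, (p i).R s x y
  · obtain ⟨x, hx⟩ := hy
    rw [amalgamIn_of_rel p hx, eq_comm, amalgamIn_eq_inl] at h
    exact ⟨x, hx, h⟩
  · by_cases hz : ∃ x, (p j).R s x z
    · obtain ⟨x, hx⟩ := hz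
      rw [amalgamIn_of_rel p hx, amalgamIn_eq_inl] at h
      exact (hy ⟨x, h⟩).elim
    · rw [amalgamIn_of_not p hy, amalgamIn_of_not p hz] at h
      simp only [Sum.inr.injEq, Sigma.mk.injEq] at h
      exact (hij h.1).elim

/-- The free amalgam of the structures `N i` and `M` along the partial isomorphisms `p i`: no
identifications besides the prescribed ones, and a relation holds only inside a single piece.
This is a structure because all function symbols are unary. -/
noncomputable def amalgam : Struct L where
  carrier s := M.carrier s ⊕ Σ i, {y : (N i).carrier s // ¬ ∃ x, (p i).R s x y}
  nonempty s := (M.nonempty s).map .inl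
  cst c := .inl (M.cst c)
  fn f := Sum.elim (fun x => .inl (M.fn f x)) (fun z => amalgamIn p z.1 _ ((N z.1).fn f z.2.1))
  rel r zs := (∃ xs, (zs = fun k => .inl (xs k)) ∧ M.rel r xs) ∨
    ∃ i ys, (zs = fun k => amalgamIn p i _ (ys k)) ∧ (N i).rel r ys

/-- The inclusion of the base into the amalgam. -/
noncomputable def amalgamInl : Emb M (amalgam p) where
  toFun _ := .inl
  inj _ := Sum.inl_injective
  map_cst _ := rfl
  map_fn _ _ := rfl
  map_rel r xs := by
    constructor
    · rintro (⟨xs', h, hr⟩ | ⟨i, ys, h, hr⟩)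
      · have : xs = xs' := funext fun k => Sum.inl_injective (congrFun h k)
        rwa [this]
      · exact ((p i).rel r fun k => (amalgamIn_eq_inl p).1 (congrFun h k).symm).2 hr
    · exact fun h => .inl ⟨xs, rfl, h⟩

/-- The inclusion of a piece into the amalgam. -/
noncomputable def amalgamInr (i : ι) : Emb (N i) (amalgam p) where
  toFun := amalgamIn p i
  inj := amalgamIn_injective p i
  map_cst c := amalgamIn_of_rel p ((p i).cst c)
  map_fn f y := by
    by_cases hy : ∃ x, (p i).R _ x y
    · obtain ⟨x, hx⟩ := hy
      rw [amalgamIn_of_rel p hx, amalgamIn_of_rel p ((p i).fn f hx)]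
      rfl
    · rw [amalgamIn_of_not p hy]
      rfl
  map_rel r ys := by
    constructor
    · rintro (⟨xs, h, hr⟩ | ⟨j, zs, h, hr⟩)
      · exact ((p i).rel r fun k => (amalgamIn_eq_inl p).1 (congrFun h k)).1 hr
      · by_cases hij : i = j
        · subst hij
          have : ys = zs := funext fun k => amalgamIn_injective p i _ (congrFun h k)
          rwa [this]
        · choose xs hx hx' using fun k => exists_rel_of_amalgamIn_eq p hij (congrFun h k)
          exact ((p i).rel r hx).1 (((p j).rel r hx').2 hr)
    · exact fun h => .inr ⟨i, ys, rfl, h⟩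

theorem amalgam_isModel {Φ : Theory L} (hΦ : ∀ φ ∈ Φ, φ.1.IsUniversalOneVar)
    (hM : Φ.IsModel M) (hN : ∀ i, Φ.IsModel (N i)) : Φ.IsModel (amalgam p) := by
  refine isModel_of_locally hΦ fun s a => ?_
  rcases a with x | ⟨i, y, hy⟩
  · exact ⟨M, amalgamInl p, x, hM, rfl⟩
  · exact ⟨N i, amalgamInr p i, y, hN i, amalgamIn_of_not p hy⟩

end Amalgam

/-- Assignments `v` and `w` (into possibly different structures) satisfy the same atomic formulas
with variables in `V`. -/
def SameType {M N : Struct L} (v : Assignment M) (w : Assignment N) (V : Set (L.Srt × ℕ)) : Prop :=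
  ∀ α : Formula L, α.IsAtomic → α.freeVars ⊆ V → (α.Realize M v ↔ α.Realize N w)

/-- Assignments in two structures which satisfy the same atomic formulas over `V` induce an
isomorphism of the substructures generated by the values of the variables in `V`. -/
def PartialIso.ofAssignments {M N : Struct L} (v : Assignment M) (w : Assignment N)
    (V : Set (L.Srt × ℕ)) (h : SameType v w V) : PartialIso M N where
  R s x y := ∃ t : Term L s, t.vars ⊆ V ∧ x = t.eval M v ∧ y = t.eval N w
  eq_iff := by
    rintro s _ _ _ _ ⟨t, ht, rfl, rfl⟩ ⟨u, hu, rfl, rfl⟩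
    exact h _ (.equal t u) (Set.union_subset ht hu)
  cst c := ⟨.cst c, Set.empty_subset _, rfl, rfl⟩
  fn := by
    rintro f _ _ ⟨t, ht, rfl, rfl⟩
    exact ⟨.app f t, ht, rfl, rfl⟩
  rel := by
    intro r xs ys hR
    choose ts hts hx hy using hR
    obtain rfl := funext hx
    obtain rfl := funext hy
    exact h _ (.rel r ts) (Set.iUnion_subset hts)

/-! ### Unions of chains -/

section Limit

variable {M : ℕ → Struct L} (e : ∀ k, Emb (M k) (M (k + 1)))

/-- Sequences of elements which eventually follow the embeddings of the chain. -/
abbrev ChainSeq (s : L.Srt) : Type :=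
  {x : ∀ k, (M k).carrier s // ∀ᶠ k in atTop, x (k + 1) = (e k).toFun s (x k)}

/-- Eventual equality of sequences. -/
instance chainSetoid (s : L.Srt) : Setoid (ChainSeq e s) where
  r x y := ∀ᶠ k in atTop, x.1 k = y.1 k
  iseqv := ⟨fun _ => .of_forall fun _ => rfl, fun h => h.mono fun _ h => h.symm,
    fun h h' => (h.and h').mono fun _ h => h.1.trans h.2⟩

/-- Every element of a member of the chain starts a sequence which follows the embeddings from there
on; its earlier entries are arbitrary elements. -/
theorem exists_chainSeq (s : L.Srt) (k : ℕ) (a : (M k).carrier s) :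
    ∃ x : ∀ k, (M k).carrier s, x k = a ∧ ∀ j ≥ k, x (j + 1) = (e j).toFun s (x j) := by
  classical
  let a' : ∀ j, (M j).carrier s := Function.update (fun j => ((M j).nonempty s).some) k a
  let x : ∀ j, (M j).carrier s := fun j => Nat.rec (motive := fun j => (M j).carrier s)
    (a' 0) (fun j b => if k = j + 1 then a' (j + 1) else (e j).toFun s b) j
  refine ⟨x, ?_, fun j hj => if_neg (by omega)⟩
  have ha : a' k = a := Function.update_self ..
  cases k with
  | zero => exact ha
  | succ k => exact (if_pos rfl).trans ha

/-- The union of a chain of embeddings: sequences of elements which eventually follow the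
embeddings, up to eventual equality. -/
noncomputable def chainLimit : Struct L where
  carrier s := Quotient (chainSetoid e s)
  nonempty s := by
    obtain ⟨x, -, hx⟩ := exists_chainSeq e s 0 ((M 0).nonempty s).some
    exact ⟨⟦⟨x, eventually_atTop.2 ⟨0, hx⟩⟩⟧⟩
  cst c := ⟦⟨fun k => (M k).cst c, .of_forall fun k => ((e k).map_cst c).symm⟩⟧
  fn f := Quotient.map
    (fun x => ⟨fun k => (M k).fn f (x.1 k), x.2.mono fun k h =>
      (congrArg _ h).trans ((e k).map_fn f _).symm⟩)
    (fun _ _ h => Eventually.mono h fun _ h => congrArg _ h)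
  rel r xs := ∀ᶠ k in atTop, (M k).rel r fun i => (xs i).out.1 k

/-- The element of the union given by an element of a member of the chain. -/
noncomputable def chainIn (k : ℕ) (s : L.Srt) (a : (M k).carrier s) : (chainLimit e).carrier s :=
  ⟦⟨(exists_chainSeq e s k a).choose,
    eventually_atTop.2 ⟨k, (exists_chainSeq e s k a).choose_spec.2⟩⟩⟧

theorem chainIn_eq {k : ℕ} {s : L.Srt} {a : (M k).carrier s} {x : ChainSeq e s}
    (ha : x.1 k = a) (hx : ∀ j ≥ k, x.1 (j + 1) = (e j).toFun s (x.1 j)) :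
    chainIn e k s a = ⟦x⟧ := by
  have h := (exists_chainSeq e s k a).choose_spec
  refine Quotient.sound (eventually_atTop.2 ⟨k, fun j hj => ?_⟩)
  induction j, hj using Nat.le_induction with
  | base => exact h.1.trans ha.symm
  | succ j hj ih => exact (h.2 j hj).trans ((congrArg _ ih).trans (hx j hj).symm)

theorem exists_chainIn_eq {s : L.Srt} (z : (chainLimit e).carrier s) :
    ∀ᶠ k in atTop, ∃ a, chainIn e k s a = z := by
  obtain ⟨x, rfl⟩ := Quotient.exists_rep z
  obtain ⟨k, hk⟩ := eventually_atTop.1 x.2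
  exact eventually_atTop.2 ⟨k, fun j hj =>
    ⟨x.1 j, chainIn_eq e rfl fun i hi => hk i (le_trans hj hi)⟩⟩

theorem chainIn_succ (k : ℕ) (s : L.Srt) (a : (M k).carrier s) :
    chainIn e (k + 1) s ((e k).toFun s a) = chainIn e k s a := by
  have h := (exists_chainSeq e s k a).choose_spec
  refine chainIn_eq e ?_ fun j hj => h.2 j (Nat.le_of_succ_le hj)
  exact (h.2 k le_rfl).trans (congrArg _ h.1)

/-- The members of a chain embed into its union. -/
noncomputable def chainEmb (k : ℕ) : Emb (M k) (chainLimit e) where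
  toFun := chainIn e k
  inj s a b h := by
    have ha := (exists_chainSeq e s k a).choose_spec
    have hb := (exists_chainSeq e s k b).choose_spec
    obtain ⟨l, hl⟩ := eventually_atTop.1 (Quotient.exact h)
    rw [← ha.1, ← hb.1]
    -- eventual equality descends to stage `k` because the embeddings are injective
    have key : ∀ d, (exists_chainSeq e s k a).choose (k + d) =
        (exists_chainSeq e s k b).choose (k + d) →
        (exists_chainSeq e s k a).choose k = (exists_chainSeq e s k b).choose k := by
      intro d
      induction d with
      | zero => exact id
      | succ d ih =>
        intro hd
        refine ih ((e (k + d)).inj s ?_)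
        rw [← ha.2 _ (Nat.le_add_right k d), ← hb.2 _ (Nat.le_add_right k d)]
        exact hd
    exact key l (hl (k + l) (Nat.le_add_left l k))
  map_cst c := chainIn_eq e rfl fun j _ => ((e j).map_cst c).symm
  map_fn f a := by
    have h := (exists_chainSeq e _ k a).choose_spec
    exact chainIn_eq e (congrArg _ h.1)
      fun j hj => (congrArg _ (h.2 j hj)).trans ((e j).map_fn f _).symm
  map_rel r xs := by
    have h := fun i => (exists_chainSeq e _ k (xs i)).choose_spec
    have hout : ∀ᶠ j in atTop, ∀ i, (chainIn e k _ (xs i)).out.1 j =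
        (exists_chainSeq e _ k (xs i)).choose j :=
      eventually_all.2 fun i => Quotient.mk_out (s := chainSetoid e _) _
    have hstage : ∀ j ≥ k, ((M j).rel r (fun i => (exists_chainSeq e _ k (xs i)).choose j) ↔
        (M k).rel r xs) := by
      intro j hj
      induction j, hj using Nat.le_induction with
      | base => rw [funext fun i => (h i).1]
      | succ j hj ih => rw [funext fun i => (h i).2 j hj, (e j).map_rel r, ih]
    constructor
    · intro hr
      obtain ⟨j, hj, hr, ho⟩ := ((eventually_ge_atTop k).and (Eventually.and hr hout)).exists
      rw [funext ho] at hr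
      exact (hstage j hj).1 hr
    · intro hr
      filter_upwards [eventually_ge_atTop k, hout] with j hj ho
      rw [funext ho]
      exact (hstage j hj).2 hr

theorem chainLimit_isModel {Φ : Theory L} (hΦ : ∀ φ ∈ Φ, φ.1.IsUniversalOneVar)
    (hM : ∀ k, Φ.IsModel (M k)) : Φ.IsModel (chainLimit e) := by
  refine isModel_of_locally hΦ fun s z => ?_
  obtain ⟨k, a, ha⟩ := (exists_chainIn_eq e z).exists
  exact ⟨M k, chainEmb e k, a, hM k, ha⟩

/-- Finitely many values of an assignment in the union already occur in a member of the chain. -/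
theorem exists_assign_chainEmb (v : Assignment (chainLimit e)) {V : Set (L.Srt × ℕ)}
    (hV : V.Finite) : ∃ (k : ℕ) (w : Assignment (M k)),
      ∀ x ∈ V, (chainEmb e k).assign w x.1 x.2 = v x.1 x.2 := by
  classical
  have h : ∀ᶠ k in atTop, ∀ x ∈ V, ∃ a, chainIn e k x.1 a = v x.1 x.2 :=
    (eventually_all_finite hV).2 fun x _ => exists_chainIn_eq e _
  obtain ⟨k, hk⟩ := h.exists
  refine ⟨k, fun s n => if hx : (s, n) ∈ V then (hk _ hx).choose else ((M k).nonempty s).some,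
    fun x hx => ?_⟩
  have := (hk x hx).choose_spec
  simp only [Emb.assign, dif_pos hx]
  exact this

end Limit

/-! ### Existentially closed models -/

/-- The formula `χ` with the value of `(s, n)` unspecified is compatible with the type of `v` over
the other variables of `χ`: some model of `Φ` contains a copy of the substructure generated by the
values under `v` of these variables, together with a solution of `χ`. -/
def Compatible (Φ : Theory L) {M : Struct L} (v : Assignment M) (χ : Formula L) (s : L.Srt)
    (n : ℕ) : Prop :=
  ∃ (N : Struct L) (w : Assignment N), Φ.IsModel N ∧
    SameType v w (χ.freeVars \ {(s, n)}) ∧ χ.Realize N w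

/-- A model of `Φ` is rich if each quantifier-free formula which is compatible with the type of
finitely many elements has a solution in the model itself. -/
def IsRich (Φ : Theory L) (M : Struct L) : Prop :=
  Φ.IsModel M ∧ ∀ χ : Formula L, χ.IsQF → ∀ (s : L.Srt) (n : ℕ) (v : Assignment M),
    Compatible Φ v χ s n → ∃ a, χ.Realize M (v.update s n a)

theorem SameType.assign {M M' N : Struct L} {v : Assignment M} {w : Assignment N}
    {V : Set (L.Srt × ℕ)} (e : Emb M M') {v' : Assignment M'} (h : SameType v' w V)
    (hv : ∀ x ∈ V, e.assign v x.1 x.2 = v' x.1 x.2) : SameType v w V := by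
  intro α hα hV
  have hqf : α.IsQF := by cases hα <;> trivial
  rw [← e.realize v hqf, α.realize_congr fun x hx => hv x (hV hx), h α hα hV]

/-- A model of `Φ` embeds into a model in which all formulas compatible with types of the given
model are solved: the free amalgam with witnesses for all of them. -/
theorem exists_emb_solving {Φ : Theory L} (hΦ : ∀ φ ∈ Φ, φ.1.IsUniversalOneVar) {M : Struct L}
    (hM : Φ.IsModel M) : ∃ (M' : Struct L) (e : Emb M M'), Φ.IsModel M' ∧
      ∀ χ : Formula L, χ.IsQF → ∀ (s : L.Srt) (n : ℕ) (v : Assignment M),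
        Compatible Φ v χ s n → ∃ a, χ.Realize M' ((e.assign v).update s n a) := by
  -- one piece for every formula compatible with some assignment
  let ι : Type := {i : Formula L × L.Srt × ℕ × Assignment M //
    Compatible Φ i.2.2.2 i.1 i.2.1 i.2.2.1}
  choose N w hN hw hχ using fun i : ι => i.2
  let p : ∀ i, PartialIso M (N i) := fun i => .ofAssignments _ _ _ (hw i)
  refine ⟨amalgam p, amalgamInl p, amalgam_isModel p hΦ hM hN, fun χ hqf s n v hc => ?_⟩
  let i : ι := ⟨(χ, s, n, v), hc⟩
  refine ⟨(amalgamInr p i).assign (w i) s n, ?_⟩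
  refine (Formula.realize_congr χ fun x hx => ?_).1 (((amalgamInr p i).realize (w i) hqf).2 (hχ i))
  by_cases h : x = (s, n)
  · subst h; simp
  · rw [Assignment.update_of_ne _ _ _ _ h]
    exact amalgamIn_of_rel p ⟨.var x.1 x.2, fun y hy => ⟨by cases hy; exact hx,
      by cases hy; exact h⟩, rfl, rfl⟩

/-- Every model of `Φ` embeds into a rich model. -/
theorem exists_emb_isRich {Φ : Theory L} (hΦ : ∀ φ ∈ Φ, φ.1.IsUniversalOneVar) {M : Struct L}
    (hM : Φ.IsModel M) : ∃ (M' : Struct L) (_ : Emb M M'), IsRich Φ M' := by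
  choose S e hS he using fun M : {M : Struct L // Φ.IsModel M} => exists_emb_solving hΦ M.2
  let C : ℕ → {M : Struct L // Φ.IsModel M} := fun k => Nat.rec ⟨M, hM⟩ (fun _ M => ⟨S M, hS M⟩) k
  let E : ∀ k, Emb (C k).1 (C (k + 1)).1 := fun k => e (C k)
  refine ⟨chainLimit E, chainEmb E 0, chainLimit_isModel E hΦ fun k => (C k).2, ?_⟩
  rintro χ hqf s n v ⟨N, w, hN, hw, hχ⟩
  -- the finitely many parameters of `χ` occur at stage `k`, and a solution is added at stage `k + 1`
  obtain ⟨k, v', hv'⟩ := exists_assign_chainEmb E v χ.freeVars_finite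
  obtain ⟨a, ha⟩ := he (C k) χ hqf s n v'
    ⟨N, w, hN, hw.assign (chainEmb E k) fun x hx => hv' x hx.1, hχ⟩
  refine ⟨(chainEmb E (k + 1)).toFun s a, ?_⟩
  refine (Formula.realize_congr χ fun x hx => ?_).1 (((chainEmb E (k + 1)).realize _ hqf).2 ha)
  by_cases h : x = (s, n)
  · subst h; simp [Emb.assign]
  · rw [Assignment.update_of_ne _ _ _ _ h, ← hv' x hx]
    simp only [Emb.assign, Assignment.update_of_ne _ _ _ _ h]
    exact chainIn_succ E k _ _

/-! ### Valuations of atomic formulas -/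

/-- The variables whose Gödel number is below `N`. -/
def varsBelow (L : DBSignature) (N : ℕ) : Set (L.Srt × ℕ) :=
  {x | Nat.pair (Encodable.encode x.1) x.2 < N}

/-- The valuation `P` of (Gödel numbers of) atomic formulas agrees with truth under `v` for the
atomic formulas with variables in `V`. -/
def Agrees (V : Set (L.Srt × ℕ)) (P : ℕ → Bool) {M : Struct L} (v : Assignment M) : Prop :=
  ∀ α : Formula L, α.IsAtomic → α.freeVars ⊆ V → (P α.code = true ↔ α.Realize M v)

/-- Simultaneous substitution of terms for variables. -/
def Term.subst (σ : (s : L.Srt) → ℕ → Term L s) : {s : L.Srt} → Term L s → Term L s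
  | _, .var s n => σ s n
  | _, .cst c => .cst c
  | _, .app f t => .app f (t.subst σ)

/-- The truth value of the substitution instance `φ[σ]` of a quantifier-free formula under a
valuation of atomic formulas; quantified formulas get the value `False`. -/
def Formula.Holds (P : ℕ → Bool) (σ : (s : L.Srt) → ℕ → Term L s) : Formula L → Prop
  | .falsum => False
  | .equal t u => P (Formula.equal (t.subst σ) (u.subst σ)).code = true
  | .rel r ts => P (Formula.rel r fun i => (ts i).subst σ).code = true
  | .imp φ ψ => φ.Holds P σ → ψ.Holds P σ
  | .all _ _ _ => False

/-- The substitution replacing all variables of sort `s` by `t`, and those of any other sort `s'`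
by `var s' 0`. -/
noncomputable def substSort (s : L.Srt) (t : Term L s) (s' : L.Srt) (_ : ℕ) : Term L s' :=
  open Classical in Function.update (fun s' => Term.var s' 0) s t s'

theorem Term.subst_vars {V : Set (L.Srt × ℕ)} {σ : (s : L.Srt) → ℕ → Term L s}
    (hσ : ∀ s n, (σ s n).vars ⊆ V) {s : L.Srt} (t : Term L s) : (t.subst σ).vars ⊆ V := by
  induction t with
  | var s n => exact hσ s n
  | cst c => exact Set.empty_subset _
  | app f t ih => exact ih

theorem substSort_vars {V : Set (L.Srt × ℕ)} (h0 : ∀ s, (s, 0) ∈ V) {s : L.Srt} {t : Term L s}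
    (ht : t.vars ⊆ V) (s' : L.Srt) (n : ℕ) : (substSort s t s' n).vars ⊆ V := by
  by_cases h : s' = s
  · subst h; simpa [substSort] using ht
  · simpa [substSort, h, Term.vars] using h0 s'

theorem substSort_same (s : L.Srt) (t : Term L s) (n : ℕ) : substSort s t s n = t := by
  simp [substSort]

theorem Term.eval_subst {M : Struct L} (v : Assignment M) (σ : (s : L.Srt) → ℕ → Term L s)
    {s : L.Srt} (t : Term L s) :
    (t.subst σ).eval M v = t.eval M fun s n => (σ s n).eval M v := by
  induction t with
  | var s n => rfl
  | cst c => rfl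
  | app f t ih => exact congrArg _ ih

/-- A substitution instance holds under the valuation given by truth under `v` iff the formula is
true under the values of the substituted terms. -/
theorem Agrees.holds_iff {V : Set (L.Srt × ℕ)} {P : ℕ → Bool} {M : Struct L} {v : Assignment M}
    (h : Agrees V P v) {σ : (s : L.Srt) → ℕ → Term L s} (hσ : ∀ s n, (σ s n).vars ⊆ V)
    {φ : Formula L} (hφ : φ.IsQF) :
    φ.Holds P σ ↔ φ.Realize M fun s n => (σ s n).eval M v := by
  induction φ with
  | falsum => rfl
  | equal t u =>
    simp only [Formula.Holds, Formula.Realize, ← Term.eval_subst]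
    exact h _ (.equal _ _) (Set.union_subset (Term.subst_vars hσ t) (Term.subst_vars hσ u))
  | rel r ts =>
    simp only [Formula.Holds, Formula.Realize, ← Term.eval_subst]
    exact h _ (.rel _ _) (Set.iUnion_subset fun i => Term.subst_vars hσ (ts i))
  | imp φ ψ ih1 ih2 => simp only [Formula.Holds, Formula.Realize, ih1 hφ.1, ih2 hφ.2]
  | all s n φ ih => exact hφ.elim

/-- The valuation `P` satisfies, for terms with variables below `N`, the axioms of equality and all
instances of the universal one-variable sentences in `Φ`. -/
structure Admissible (Φ : Theory L) (N : ℕ) (P : ℕ → Bool) : Prop where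
  refl : ∀ s (t : Term L s), t.vars ⊆ varsBelow L N → P (Formula.equal t t).code = true
  symm : ∀ s (t : Term L s), t.vars ⊆ varsBelow L N → ∀ u : Term L s, u.vars ⊆ varsBelow L N →
    P (Formula.equal t u).code = true → P (Formula.equal u t).code = true
  trans : ∀ s (t : Term L s), t.vars ⊆ varsBelow L N → ∀ u : Term L s, u.vars ⊆ varsBelow L N →
    ∀ w : Term L s, w.vars ⊆ varsBelow L N → P (Formula.equal t u).code = true →
    P (Formula.equal u w).code = true → P (Formula.equal t w).code = true
  app : ∀ f, ∀ t : Term L (L.dom f), t.vars ⊆ varsBelow L N →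
    ∀ u : Term L (L.dom f), u.vars ⊆ varsBelow L N → P (Formula.equal t u).code = true →
    P (Formula.equal (.app f t) (.app f u)).code = true
  rel : ∀ r, ∀ ts : (i : Fin (L.arity r)) → Term L (L.relSort r i),
    (∀ i, (ts i).vars ⊆ varsBelow L N) →
    ∀ us : (i : Fin (L.arity r)) → Term L (L.relSort r i), (∀ i, (us i).vars ⊆ varsBelow L N) →
    (∀ i, P (Formula.equal (ts i) (us i)).code = true) →
    P (Formula.rel r ts).code = true → P (Formula.rel r us).code = true
  ax : ∀ φ ∈ Φ, ∀ s n ψ, φ.1 = .all s n ψ → ∀ t : Term L s, t.vars ⊆ varsBelow L N →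
    ψ.Holds P (substSort s t)

/-- Truth in a model gives an admissible valuation. -/
theorem Agrees.admissible {Φ : Theory L} (hΦ : ∀ φ ∈ Φ, φ.1.IsUniversalOneVar) {N : ℕ}
    (h0 : ∀ s, (s, 0) ∈ varsBelow L N) {P : ℕ → Bool} {M : Struct L} {v : Assignment M}
    (hM : Φ.IsModel M) (h : Agrees (varsBelow L N) P v) : Admissible Φ N P := by
  have heq : ∀ {s} (t u : Term L s), t.vars ⊆ varsBelow L N → u.vars ⊆ varsBelow L N →
      (P (Formula.equal t u).code = true ↔ t.eval M v = u.eval M v) :=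
    fun t u ht hu => h _ (.equal t u) (Set.union_subset ht hu)
  constructor
  · intro s t ht
    rw [heq t t ht ht]
  · intro s t ht u hu
    rw [heq t u ht hu, heq u t hu ht]
    exact Eq.symm
  · intro s t ht u hu w hw
    rw [heq t u ht hu, heq u w hu hw, heq t w ht hw]
    exact Eq.trans
  · intro f t ht u hu
    rw [heq t u ht hu, heq (.app f t) (.app f u) ht hu]
    exact congrArg (M.fn f)
  · intro r ts hts us hus htu
    rw [h _ (.rel r ts) (Set.iUnion_subset hts), h _ (.rel r us) (Set.iUnion_subset hus)]
    simp only [Formula.Realize]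
    rw [funext fun i => (heq _ _ (hts i) (hus i)).1 (htu i)]
    exact id
  · intro φ hφ s n ψ e t ht
    obtain ⟨s', n', ψ', hψ, hv, e'⟩ := hΦ φ hφ
    rw [e] at e'
    cases e'
    rw [h.holds_iff (substSort_vars h0 ht) hψ]
    have hm := hM φ hφ v
    rw [e] at hm
    refine (Formula.realize_congr ψ fun x hx => ?_).1 (hm (t.eval M v))
    obtain rfl : x = (s, n) := hv hx
    simp [substSort_same]

section Herbrand

variable {Φ : Theory L} {N : ℕ} {P : ℕ → Bool} (h : Admissible Φ N P)

/-- The terms with variables below `N`, up to the equations which hold under `P`. -/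
def herbrandSetoid (s : L.Srt) : Setoid {t : Term L s // t.vars ⊆ varsBelow L N} where
  r t u := P (Formula.equal t.1 u.1).code = true
  iseqv := ⟨fun t => h.refl s t.1 t.2, fun {t u} => h.symm s t.1 t.2 u.1 u.2,
    fun {t u w} => h.trans s t.1 t.2 u.1 u.2 w.1 w.2⟩

/-- The structure of terms with variables below `N` modulo the equations which hold under `P`. -/
noncomputable def herbrand (h0 : ∀ s, (s, 0) ∈ varsBelow L N) : Struct L where
  carrier s := Quotient (herbrandSetoid h s)
  nonempty s := ⟨Quotient.mk _ ⟨.var s 0, Set.singleton_subset_iff.2 (h0 s)⟩⟩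
  cst c := Quotient.mk _ ⟨.cst c, Set.empty_subset _⟩
  fn f := Quotient.map (fun t => ⟨.app f t.1, t.2⟩) fun t u => h.app f t.1 t.2 u.1 u.2
  rel r xs := P (Formula.rel r fun i => (xs i).out.1).code = true

variable (h0 : ∀ s, (s, 0) ∈ varsBelow L N)

/-- The assignment into the term structure given by a substitution. -/
noncomputable def herbrandAssign (σ : (s : L.Srt) → ℕ → Term L s)
    (hσ : ∀ s n, (σ s n).vars ⊆ varsBelow L N) : Assignment (herbrand h h0) :=
  fun s n => Quotient.mk _ ⟨σ s n, hσ s n⟩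

theorem herbrand_eval (σ : (s : L.Srt) → ℕ → Term L s)
    (hσ : ∀ s n, (σ s n).vars ⊆ varsBelow L N) {s : L.Srt} (t : Term L s) :
    t.eval (herbrand h h0) (herbrandAssign h h0 σ hσ) =
      Quotient.mk _ ⟨t.subst σ, Term.subst_vars hσ t⟩ := by
  induction t with
  | var s n => rfl
  | cst c => rfl
  | app f t ih => simp only [Term.eval, ih]; rfl

/-- Truth in the term structure is truth under the valuation. Congruence for relations makes the
choice of representatives in the definition of the term structure irrelevant. -/
theorem herbrand_realize {σ : (s : L.Srt) → ℕ → Term L s}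
    (hσ : ∀ s n, (σ s n).vars ⊆ varsBelow L N) {φ : Formula L} (hφ : φ.IsQF) :
    φ.Realize (herbrand h h0) (herbrandAssign h h0 σ hσ) ↔ φ.Holds P σ := by
  induction φ with
  | falsum => rfl
  | equal t u =>
    simp only [Formula.Realize, Formula.Holds, herbrand_eval]
    exact Quotient.eq (r := herbrandSetoid h _)
  | rel r ts =>
    simp only [Formula.Realize, Formula.Holds, herbrand_eval]
    let q i := (Quotient.mk (herbrandSetoid h _)
      ⟨(ts i).subst σ, Term.subst_vars hσ (ts i)⟩).out
    have hq i : P (Formula.equal (q i).1 ((ts i).subst σ)).code = true :=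
      Quotient.mk_out (s := herbrandSetoid h _) _
    exact ⟨h.rel r (fun i => (q i).1) (fun i => (q i).2) _ (fun i => Term.subst_vars hσ (ts i)) hq,
      h.rel r _ (fun i => Term.subst_vars hσ (ts i)) (fun i => (q i).1) (fun i => (q i).2)
        fun i => h.symm _ _ (q i).2 _ (Term.subst_vars hσ (ts i)) (hq i)⟩
  | imp φ ψ ih1 ih2 => simp only [Formula.Holds, Formula.Realize, ih1 hφ.1, ih2 hφ.2]
  | all s n φ ih => exact hφ.elim

end Herbrand

/-- An admissible valuation is given by truth in a model, namely in the structure of terms modulo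
provable equality. -/
theorem Admissible.exists_agrees {Φ : Theory L} (hΦ : ∀ φ ∈ Φ, φ.1.IsUniversalOneVar) {N : ℕ}
    (h0 : ∀ s, (s, 0) ∈ varsBelow L N) {P : ℕ → Bool} (h : Admissible Φ N P) :
    ∃ (M : Struct L) (v : Assignment M), Φ.IsModel M ∧ Agrees (varsBelow L N) P v := by
  classical
  -- variables not below `N` are irrelevant, so they may take the value of `var s 0`
  let σ : (s : L.Srt) → ℕ → Term L s := fun s n =>
    if (s, n) ∈ varsBelow L N then .var s n else .var s 0
  have hσ : ∀ s n, (σ s n).vars ⊆ varsBelow L N := by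
    intro s n
    by_cases hn : (s, n) ∈ varsBelow L N
    · simp [σ, hn, Term.vars]
    · simpa [σ, hn, Term.vars] using h0 s
  have hsub : ∀ {s} (t : Term L s), t.vars ⊆ varsBelow L N → t.subst σ = t := by
    intro s t ht
    induction t with
    | var s n => exact if_pos (ht rfl)
    | cst c => rfl
    | app f t ih => exact congrArg _ (ih ht)
  refine ⟨herbrand h h0, herbrandAssign h h0 σ hσ, fun φ hφ v => ?_, fun α hα hV => ?_⟩
  · obtain ⟨s, n, ψ, hψ, hv, e⟩ := hΦ φ hφ
    rw [e]
    intro a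
    obtain ⟨t, rfl⟩ := Quotient.exists_rep (s := herbrandSetoid h s) a
    refine (Formula.realize_congr ψ fun x hx => ?_).1
      ((herbrand_realize h h0 (substSort_vars h0 t.2) hψ).2 (h.ax φ hφ s n ψ e t.1 t.2))
    obtain rfl : x = (s, n) := hv hx
    exact (congrArg (Quotient.mk (herbrandSetoid h s)) (Subtype.ext (substSort_same s t.1 n))).trans
      (Assignment.update_same v s n _).symm
  · cases hα with
    | equal t u =>
      rw [herbrand_realize h h0 hσ (by trivial)]
      simp only [Formula.Holds, hsub t (Set.subset_union_left.trans hV),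
        hsub u (Set.subset_union_right.trans hV)]
    | rel r ts =>
      rw [herbrand_realize h h0 hσ (by trivial)]
      simp only [Formula.Holds, fun i => hsub (ts i) ((Set.subset_iUnion _ i).trans hV)]

/-! ### Recognizing Gödel numbers -/

/-- The variables whose Gödel number occurs in the list `l`. -/
def varsIn (L : DBSignature) (l : List ℕ) : Set (L.Srt × ℕ) :=
  {x | Nat.pair (encode x.1) x.2 ∈ l}

theorem varsIn_range (N : ℕ) : varsIn L (List.range N) = varsBelow L N := by
  ext x; simp [varsIn, varsBelow]

/-- The sort of the term with variables in `l` which has the given Gödel number, if there is such a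
term. -/
noncomputable def sortOf (L : DBSignature) (l : List ℕ) : ℕ → Option L.Srt :=
  codeRec (fun n => if n.unpair.2 ∈ l then decode₂ L.Srt n.unpair.2.unpair.1 else none)
    fun n _ o => if n.unpair.1 = 1 then (decode₂ L.Cst n.unpair.2).map L.cstSort
      else if n.unpair.1 = 2 then (decode₂ L.Fn n.unpair.2.unpair.1).bind fun f =>
        open Classical in if o = some (L.dom f) then some (L.cod f) else none
      else none

theorem sortOf_code {l : List ℕ} {s : L.Srt} (t : Term L s) (ht : t.vars ⊆ varsIn L l) :
    sortOf L l t.code = some s := by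
  induction t with
  | var s n =>
    have : Nat.pair (encode s) n ∈ l := ht rfl
    rw [sortOf, codeRec_of_tag_zero _ _ (by simp [Term.code])]
    simp [Term.code, this]
  | cst c =>
    rw [sortOf, codeRec_of_tag_ne_zero _ _ (by simp [Term.code])]
    simp [Term.code]
  | app f t ih =>
    have := ih ht
    rw [sortOf] at this
    rw [sortOf, codeRec_of_tag_ne_zero _ _ (by simp [Term.code])]
    simp [Term.code, this]

theorem exists_term_of_sortOf {l : List ℕ} (n : ℕ) {s : L.Srt} (h : sortOf L l n = some s) :
    ∃ t : Term L s, t.vars ⊆ varsIn L l ∧ t.code = n := by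
  induction n using Nat.strong_induction_on generalizing s with
  | _ n ih =>
    rw [sortOf] at h
    by_cases h0 : n.unpair.1 = 0
    · rw [codeRec_of_tag_zero _ _ h0] at h
      split_ifs at h with hm
      have hs : encode s = n.unpair.2.unpair.1 := mem_decode₂.1 h
      refine ⟨.var s n.unpair.2.unpair.2, ?_, ?_⟩
      · refine Set.singleton_subset_iff.2 ?_
        simpa [varsIn, hs] using hm
      · rw [Term.code, hs, Nat.pair_unpair, ← h0, Nat.pair_unpair]
    · rw [codeRec_of_tag_ne_zero _ _ h0] at h
      split_ifs at h with h1 h2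
      · obtain ⟨c, hc, rfl⟩ := Option.map_eq_some_iff.1 h
        have hc : encode c = n.unpair.2 := mem_decode₂.1 hc
        exact ⟨.cst c, Set.empty_subset _, by rw [Term.code, hc, ← h1, Nat.pair_unpair]⟩
      · obtain ⟨f, hf, hs⟩ := Option.bind_eq_some_iff.1 h
        have hf : encode f = n.unpair.2.unpair.1 := mem_decode₂.1 hf
        split_ifs at hs with ho
        cases hs
        obtain ⟨t, ht, e⟩ := ih _ ((Nat.unpair_right_le _).trans_lt (unpair_right_lt h0)) ho
        exact ⟨.app f t, ht, by rw [Term.code, hf, e, Nat.pair_unpair, ← h2, Nat.pair_unpair]⟩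

theorem primrec_sortOf : Primrec₂ (sortOf L) := by
  classical
  have h1 : Primrec L.cstSort := .dom_finite _
  have h2 : Primrec fun x : L.Fn × Option L.Srt =>
      if x.2 = some (L.dom x.1) then some (L.cod x.1) else none := .dom_finite _
  refine primrec_codeRec (by fun_prop) (Primrec.ite (by fun_prop) ?_
    (Primrec.ite (by fun_prop) ?_ (.const _)))
  · exact Primrec.option_map (by fun_prop) (h1.comp Primrec.snd)
  · refine Primrec.option_bind (by fun_prop) (h2.comp (Primrec.snd.pair ?_))
    exact Primrec.snd.comp (Primrec.snd.comp (Primrec.snd.comp Primrec.fst))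

@[fun_prop] theorem primrec_sortOf_comp {α : Type} [Primcodable α] {l : α → List ℕ} {n : α → ℕ}
    (hl : Primrec l) (hn : Primrec n) : Primrec fun a => sortOf L (l a) (n a) :=
  primrec_sortOf.comp hl hn

/-- The number `n` codes the arguments of the relation symbol `r` in an atomic formula with
variables in `l`. -/
def IsArgs (r : L.Rl) (l : List ℕ) (n : ℕ) : Prop :=
  (Denumerable.ofNat (List ℕ) n).map (sortOf L l) = List.ofFn fun i => some (L.relSort r i)

/-- The number coding a tuple of terms. -/
def argsCode {r : L.Rl} (ts : (i : Fin (L.arity r)) → Term L (L.relSort r i)) : ℕ :=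
  encode (List.ofFn fun i => (ts i).code)

theorem isArgs_iff {r : L.Rl} {l : List ℕ} {n : ℕ} : IsArgs r l n ↔
    ∃ ts : (i : Fin (L.arity r)) → Term L (L.relSort r i),
      (∀ i, (ts i).vars ⊆ varsIn L l) ∧ argsCode ts = n := by
  constructor
  · intro h
    have hlen : (Denumerable.ofNat (List ℕ) n).length = L.arity r := by
      simpa using congrArg List.length h
    have hi : ∀ i : Fin (L.arity r), ∃ t : Term L (L.relSort r i), t.vars ⊆ varsIn L l ∧
        t.code = (Denumerable.ofNat (List ℕ) n)[i.1]'(by omega) := by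
      intro i
      apply exists_term_of_sortOf
      have := congrArg (fun l => l[i.1]?) h
      simpa [hlen] using this
    choose ts hts hc using hi
    refine ⟨ts, hts, ?_⟩
    rw [argsCode, ← Denumerable.encode_ofNat (α := List ℕ) n]
    congr 1
    apply List.ext_getElem
    · simp [hlen]
    · intro i h1 h2
      simp [hc]
  · rintro ⟨ts, hts, rfl⟩
    rw [IsArgs, argsCode, Denumerable.ofNat_encode, List.map_ofFn]
    congr 1
    funext i
    exact sortOf_code _ (hts i)

theorem primrec_isArgs {α : Type} [Primcodable α] (r : L.Rl) {l : α → List ℕ} {n : α → ℕ}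
    (hl : Primrec l) (hn : Primrec n) : PrimrecPred fun a => IsArgs r (l a) (n a) := by
  refine PrimrecPred.eq_comp (Primrec.list_map ((Primrec.ofNat _).comp hn) ?_) (.const _)
  exact primrec_sortOf_comp (hl.comp Primrec.fst) Primrec.snd

/-- The number `n` is the Gödel number of an atomic formula with variables in `l`. -/
def IsAtomCode (L : DBSignature) (l : List ℕ) (n : ℕ) : Prop :=
  (n.unpair.1 = 1 ∧ sortOf L l n.unpair.2.unpair.1 ≠ none ∧
    sortOf L l n.unpair.2.unpair.1 = sortOf L l n.unpair.2.unpair.2) ∨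
  (n.unpair.1 = 2 ∧ ¬ ∀ r : L.Rl, ¬ (n.unpair.2.unpair.1 = encode r ∧
    IsArgs r l n.unpair.2.unpair.2))

@[fun_prop] theorem primrec_isAtomCode {α : Type} [Primcodable α] {l : α → List ℕ} {n : α → ℕ}
    (hl : Primrec l) (hn : Primrec n) : PrimrecPred fun a => IsAtomCode L (l a) (n a) := by
  have h : PrimrecPred fun a => ∀ r : L.Rl, ¬ ((n a).unpair.2.unpair.1 = encode r ∧
      IsArgs r (l a) (n a).unpair.2.unpair.2) := by
    refine PrimrecPred.forall_finite fun r => ?_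
    have := primrec_isArgs r hl (n := fun a => (n a).unpair.2.unpair.2) (by fun_prop)
    fun_prop
  unfold IsAtomCode
  fun_prop

theorem isAtomCode_iff {l : List ℕ} {n : ℕ} : IsAtomCode L l n ↔
    ∃ α : Formula L, α.IsAtomic ∧ α.freeVars ⊆ varsIn L l ∧ α.code = n := by
  constructor
  · rintro (⟨h1, h2, h3⟩ | ⟨h1, h2⟩)
    · obtain ⟨s, hs⟩ := Option.ne_none_iff_exists'.1 h2
      obtain ⟨t, ht, et⟩ := exists_term_of_sortOf _ hs
      obtain ⟨u, hu, eu⟩ := exists_term_of_sortOf _ (h3 ▸ hs)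
      refine ⟨.equal t u, .equal t u, Set.union_subset ht hu, ?_⟩
      rw [Formula.code, et, eu, Nat.pair_unpair, ← h1, Nat.pair_unpair]
    · push Not at h2
      obtain ⟨r, hr, ha⟩ := h2
      obtain ⟨ts, hts, e⟩ := isArgs_iff.1 ha
      refine ⟨.rel r ts, .rel r ts, Set.iUnion_subset hts, ?_⟩
      rw [argsCode] at e
      rw [Formula.code, e, ← hr, Nat.pair_unpair, ← h1, Nat.pair_unpair]
  · rintro ⟨_, ⟨t, u⟩ | ⟨r, ts⟩, hv, rfl⟩
    · have ht := sortOf_code t (Set.subset_union_left.trans hv)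
      have hu := sortOf_code u (Set.subset_union_right.trans hv)
      exact .inl (by simp [Formula.code, ht, hu])
    · refine .inr ⟨by simp [Formula.code], fun h => h r ⟨by simp [Formula.code], isArgs_iff.2
        ⟨ts, fun i => (Set.subset_iUnion _ i).trans hv, by simp [Formula.code, argsCode]⟩⟩⟩

open Classical in
/-- Whether the given number is the Gödel number of a quantifier-free formula with variables
in `l`. -/
noncomputable def isQFCode (L : DBSignature) (l : List ℕ) : ℕ → Bool :=
  codeRec (fun n => decide (n = 0))
    fun n x y => if n.unpair.1 = 3 then x && y else decide (IsAtomCode L l n)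

@[fun_prop] theorem primrec_isQFCode {α : Type} [Primcodable α] {l : α → List ℕ} {n : α → ℕ}
    (hl : Primrec l) (hn : Primrec n) : Primrec fun a => isQFCode L (l a) (n a) := by
  have h : Primrec₂ (isQFCode L) := primrec_codeRec (by fun_prop) (by fun_prop)
  exact h.comp hl hn

theorem isQFCode_iff {l : List ℕ} (n : ℕ) : isQFCode L l n = true ↔
    ∃ φ : Formula L, φ.IsQF ∧ φ.freeVars ⊆ varsIn L l ∧ φ.code = n := by
  constructor
  · induction n using Nat.strong_induction_on with
    | _ n ih =>
      intro h
      rw [isQFCode] at h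
      by_cases h0 : n.unpair.1 = 0
      · rw [codeRec_of_tag_zero _ _ h0] at h
        have h : n = 0 := by simpa using h
        subst h
        exact ⟨.falsum, trivial, Set.empty_subset _, rfl⟩
      · rw [codeRec_of_tag_ne_zero _ _ h0] at h
        split_ifs at h with h3
        · rw [Bool.and_eq_true] at h
          obtain ⟨φ, h1, h2, e⟩ := ih _ ((Nat.unpair_left_le _).trans_lt (unpair_right_lt h0)) h.1
          obtain ⟨ψ, h1', h2', e'⟩ :=
            ih _ ((Nat.unpair_right_le _).trans_lt (unpair_right_lt h0)) h.2
          refine ⟨.imp φ ψ, ⟨h1, h1'⟩, Set.union_subset h2 h2', ?_⟩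
          rw [Formula.code, e, e', Nat.pair_unpair, ← h3, Nat.pair_unpair]
        · obtain ⟨α, hα, hv, e⟩ := isAtomCode_iff.1 (by simpa using h)
          exact ⟨α, by cases hα <;> trivial, hv, e⟩
  · rintro ⟨φ, hφ, hv, rfl⟩
    induction φ with
    | falsum =>
      rw [isQFCode, codeRec_of_tag_zero _ _ (by simp [Formula.code])]
      exact decide_eq_true rfl
    | equal t u =>
      rw [isQFCode, codeRec_of_tag_ne_zero _ _ (by simp [Formula.code]),
        if_neg (by simp [Formula.code])]
      simpa using isAtomCode_iff.2 ⟨_, .equal t u, hv, rfl⟩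
    | rel r ts =>
      rw [isQFCode, codeRec_of_tag_ne_zero _ _ (by simp [Formula.code]),
        if_neg (by simp [Formula.code])]
      simpa using isAtomCode_iff.2 ⟨_, .rel r ts, hv, rfl⟩
    | imp φ ψ ih1 ih2 =>
      have h1 := ih1 hφ.1 (Set.subset_union_left.trans hv)
      have h2 := ih2 hφ.2 (Set.subset_union_right.trans hv)
      rw [isQFCode] at h1 h2 ⊢
      rw [codeRec_of_tag_ne_zero _ _ (by simp [Formula.code]), if_pos (by simp [Formula.code])]
      simp [Formula.code, h1, h2]
    | all s n φ ih => exact hφ.elim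

/-- The truth value, under a valuation of atomic formulas, of the quantifier-free formula with the
given Gödel number. -/
def evalCode (P : ℕ → Bool) : ℕ → Bool :=
  codeRec (fun _ => false) fun n x y => if n.unpair.1 = 3 then !x || y else P n

@[fun_prop] theorem primrec_evalCode {α : Type} [Primcodable α] {m n : α → ℕ}
    (hm : Primrec m) (hn : Primrec n) : Primrec fun a => evalCode (m a).testBit (n a) := by
  have h : Primrec₂ fun m n : ℕ => evalCode m.testBit n :=
    primrec_codeRec (by fun_prop) (by fun_prop)
  exact h.comp hm hn

@[simp] theorem evalCode_falsum (P : ℕ → Bool) :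
    evalCode P (Formula.falsum : Formula L).code = false :=
  codeRec_of_tag_zero _ _ (by simp [Formula.code])

theorem evalCode_atomic (P : ℕ → Bool) {α : Formula L} (hα : α.IsAtomic) :
    evalCode P α.code = P α.code := by
  rw [evalCode, codeRec_of_tag_ne_zero, if_neg] <;> cases hα <;> simp [Formula.code]

@[simp] theorem evalCode_imp (P : ℕ → Bool) (φ ψ : Formula L) :
    evalCode P (φ.imp ψ).code = (!evalCode P φ.code || evalCode P ψ.code) := by
  rw [evalCode, codeRec_of_tag_ne_zero _ _ (by simp [Formula.code]),
    if_pos (by simp [Formula.code])]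
  simp [Formula.code]

theorem Agrees.evalCode_iff {V : Set (L.Srt × ℕ)} {P : ℕ → Bool} {M : Struct L}
    {v : Assignment M} (h : Agrees V P v) {φ : Formula L} (hφ : φ.IsQF) (hV : φ.freeVars ⊆ V) :
    evalCode P φ.code = true ↔ φ.Realize M v := by
  induction φ with
  | falsum => simp [Formula.Realize]
  | equal t u => rw [evalCode_atomic P (.equal t u), h _ (.equal t u) hV]
  | rel r ts => rw [evalCode_atomic P (.rel r ts), h _ (.rel r ts) hV]
  | imp φ ψ ih1 ih2 =>
    rw [Formula.Realize, ← ih1 hφ.1 (Set.subset_union_left.trans hV),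
      ← ih2 hφ.2 (Set.subset_union_right.trans hV), evalCode_imp]
    cases evalCode P φ.code <;> simp
  | all s n φ ih => exact hφ.elim

/-! ### Bounded quantification over terms -/

theorem natPair_mono {a b c d : ℕ} (h : a ≤ c) (h' : b ≤ d) : Nat.pair a b ≤ Nat.pair c d := by
  have h1 : Nat.pair a b ≤ Nat.pair c b := by
    rcases h.eq_or_lt with rfl | h
    exacts [le_rfl, (Nat.pair_lt_pair_left b h).le]
  rcases h'.eq_or_lt with rfl | h'
  exacts [h1, h1.trans (Nat.pair_lt_pair_right c h').le]

/-- In an acyclic signature the terms over the variables below `N` have bounded Gödel numbers: by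
well-founded induction along the sort graph, since an application of `f` takes its argument from
a strictly smaller sort. -/
theorem exists_term_bound (hL : L.Acyclic) : ∃ b : ℕ → ℕ, Primrec b ∧
    ∀ N s (t : Term L s), t.vars ⊆ varsBelow L N → t.code ≤ b N := by
  have : Std.Irrefl (Relation.TransGen L.Edge) := ⟨hL⟩
  have wf : WellFounded (Relation.TransGen L.Edge) := Finite.wellFounded_of_trans_of_irrefl _
  have key : ∀ s, ∃ b : ℕ → ℕ, Primrec b ∧
      ∀ N s' (t : Term L s'), s' = s → t.vars ⊆ varsBelow L N → t.code ≤ b N := by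
    intro s
    induction s using wf.induction with
    | _ s ih =>
      choose b hb hbt using fun f : {f : L.Fn // L.cod f = s} =>
        ih (L.dom f.1) (.single ⟨f.1, rfl, f.2⟩)
      obtain ⟨b1, hb1, h1⟩ := Primrec.exists_bound_of_finite
        (f := fun (f : {f : L.Fn // L.cod f = s}) N => Nat.pair 2 (Nat.pair (encode f.1) (b f N)))
        (fun f => by have := hb f; fun_prop)
      obtain ⟨b2, hb2, h2⟩ := Primrec.exists_bound_of_finite
        (f := fun (c : L.Cst) _ => Nat.pair 1 (encode c)) (fun c => by fun_prop)
      refine ⟨fun N => Nat.pair 0 N + (b1 N + b2 N), by fun_prop, fun N s' t hs ht => ?_⟩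
      cases t with
      | var _ n =>
        have : Nat.pair (encode s') n < N := ht rfl
        exact (Nat.pair_lt_pair_right 0 this).le.trans (Nat.le_add_right _ _)
      | cst c => exact (h2 c N).trans ((Nat.le_add_left _ _).trans (Nat.le_add_left _ _))
      | app f t =>
        refine le_trans ?_ ((h1 ⟨f, hs⟩ N).trans ((Nat.le_add_right _ _).trans (Nat.le_add_left _ _)))
        exact natPair_mono le_rfl (natPair_mono le_rfl (hbt ⟨f, hs⟩ N _ t rfl ht))
  choose b hb hbt using key
  obtain ⟨g, hg, h⟩ := Primrec.exists_bound_of_finite hb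
  exact ⟨g, hg, fun N s t ht => (hbt s N s t rfl ht).trans (h s N)⟩

theorem exists_list_bound (k : ℕ) : ∃ g : ℕ → ℕ, Primrec g ∧
    ∀ B (l : List ℕ), l.length = k → (∀ x ∈ l, x ≤ B) → encode l ≤ g B := by
  induction k with
  | zero =>
    refine ⟨fun _ => 0, by fun_prop, fun B l hl _ => ?_⟩
    obtain rfl := List.length_eq_zero_iff.1 hl
    simp
  | succ k ih =>
    obtain ⟨g, hg, h⟩ := ih
    refine ⟨fun B => Nat.pair B (g B) + 1, by fun_prop, fun B l hl hB => ?_⟩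
    cases l with
    | nil => simp at hl
    | cons a l =>
      rw [encode_list_cons]
      exact Nat.succ_le_succ (natPair_mono (hB a (by simp))
        (h B l (by simpa using hl) fun x hx => hB x (by simp [hx])))

theorem exists_args_bound (hL : L.Acyclic) : ∃ b : ℕ → ℕ, Primrec b ∧
    ∀ N r (ts : (i : Fin (L.arity r)) → Term L (L.relSort r i)),
      (∀ i, (ts i).vars ⊆ varsBelow L N) → argsCode ts ≤ b N := by
  obtain ⟨b, hb, hbt⟩ := exists_term_bound hL
  choose g hg h using exists_list_bound
  obtain ⟨b', hb', h'⟩ := Primrec.exists_bound_of_finite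
    (f := fun (r : L.Rl) N => g (L.arity r) (b N)) (fun r => (hg _).comp hb)
  refine ⟨b', hb', fun N r ts hts => le_trans (h _ _ _ (by simp) ?_) (h' r N)⟩
  intro x hx
  obtain ⟨i, rfl⟩ := (List.mem_ofFn' _ _).1 hx
  exact hbt N _ _ (hts i)

theorem exists_atom_bound (hL : L.Acyclic) : ∃ A : ℕ → ℕ, Primrec A ∧
    ∀ N (α : Formula L), α.IsAtomic → α.freeVars ⊆ varsBelow L N → α.code < A N := by
  obtain ⟨b, hb, hbt⟩ := exists_term_bound hL
  obtain ⟨c, hc, hct⟩ := exists_args_bound hL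
  obtain ⟨d, hd, hdt⟩ := Primrec.exists_bound_of_finite
    (f := fun (r : L.Rl) N => Nat.pair 2 (Nat.pair (encode r) (c N))) (fun r => by fun_prop)
  refine ⟨fun N => Nat.pair 1 (Nat.pair (b N) (b N)) + d N + 1, by fun_prop, ?_⟩
  rintro N _ ⟨t, u⟩ hv
  · have : (Formula.equal t u).code ≤ Nat.pair 1 (Nat.pair (b N) (b N)) :=
      natPair_mono le_rfl (natPair_mono (hbt N _ t (Set.subset_union_left.trans hv))
        (hbt N _ u (Set.subset_union_right.trans hv)))
    dsimp only
    omega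
  · rename_i r ts
    have : (Formula.rel r ts).code ≤ Nat.pair 2 (Nat.pair (encode r) (c N)) :=
      natPair_mono le_rfl (natPair_mono le_rfl
        (hct N r ts fun i => (Set.subset_iUnion _ i).trans hv))
    have := hdt r N
    dsimp only at this ⊢
    omega

section Quantifiers

variable {α : Type} [Primcodable α]

/-- Quantification over all terms of sort `s` with variables below `N a` preserves primitive
recursion, as it is a bounded quantification over Gödel numbers. The property of terms is given by a
property `p` of their Gödel numbers. -/
theorem primrecPred_forall_term (hL : L.Acyclic) (s : L.Srt) {N : α → ℕ} (hN : Primrec N)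
    {q : α → Term L s → Prop} (p : α → ℕ → Prop) (hp : PrimrecPred fun x : α × ℕ => p x.1 x.2)
    (h : ∀ a t, p a t.code ↔ q a t) :
    PrimrecPred fun a => ∀ t : Term L s, t.vars ⊆ varsBelow L (N a) → q a t := by
  obtain ⟨b, hb, hbt⟩ := exists_term_bound hL
  have h1 : PrimrecPred fun a => ∀ n < b (N a) + 1,
      sortOf L (List.range (N a)) n = some s → p a n := by fun_prop
  refine h1.of_eq fun a => ⟨fun H t ht => (h a t).1 (H _ ?_ ?_), fun H n _ hs => ?_⟩
  · exact Nat.lt_succ_of_le (hbt _ _ t ht)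
  · exact sortOf_code t (by rwa [varsIn_range])
  · obtain ⟨t, ht, rfl⟩ := exists_term_of_sortOf n hs
    rw [varsIn_range] at ht
    exact (h a t).2 (H t ht)

/-- The analogue of `primrecPred_forall_term` for tuples of arguments of a relation symbol. -/
theorem primrecPred_forall_args (hL : L.Acyclic) (r : L.Rl) {N : α → ℕ} (hN : Primrec N)
    {q : α → ((i : Fin (L.arity r)) → Term L (L.relSort r i)) → Prop} (p : α → ℕ → Prop)
    (hp : PrimrecPred fun x : α × ℕ => p x.1 x.2) (h : ∀ a ts, p a (argsCode ts) ↔ q a ts) :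
    PrimrecPred fun a => ∀ ts : (i : Fin (L.arity r)) → Term L (L.relSort r i),
      (∀ i, (ts i).vars ⊆ varsBelow L (N a)) → q a ts := by
  obtain ⟨b, hb, hbt⟩ := exists_args_bound hL
  have h0 : PrimrecPred fun x : α × ℕ => IsArgs r (List.range (N x.1)) x.2 :=
    primrec_isArgs r (by fun_prop) (by fun_prop)
  have h1 : PrimrecPred fun a => ∀ n < b (N a) + 1, IsArgs r (List.range (N a)) n → p a n := by
    fun_prop
  refine h1.of_eq fun a => ⟨fun H ts hts => (h a ts).1 (H _ ?_ ?_), fun H n _ hs => ?_⟩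
  · exact Nat.lt_succ_of_le (hbt _ _ ts hts)
  · exact isArgs_iff.2 ⟨ts, by rwa [varsIn_range], rfl⟩
  · obtain ⟨ts, hts, rfl⟩ := isArgs_iff.1 hs
    rw [varsIn_range] at hts
    exact (h a ts).2 (H ts hts)

end Quantifiers

/-! ### Decidability of admissibility -/

theorem exists_primrec_subst {s : L.Srt} {s' : L.Srt} (u : Term L s') :
    ∃ f : ℕ → ℕ, Primrec f ∧ ∀ t : Term L s, f t.code = (u.subst (substSort s t)).code := by
  induction u with
  | var s' n =>
    by_cases h : s' = s
    · subst h
      exact ⟨id, Primrec.id, fun t => by rw [Term.subst, substSort_same]; rfl⟩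
    · exact ⟨fun _ => (Term.var s' 0).code, by fun_prop, fun t => by
        simp [Term.subst, substSort, h]⟩
  | cst c => exact ⟨fun _ => (Term.cst c).code, by fun_prop, fun t => rfl⟩
  | app g u ih =>
    obtain ⟨f, hf, h⟩ := ih
    exact ⟨fun n => Nat.pair 2 (Nat.pair (encode g) (f n)), by fun_prop, fun t => by
      simp only [Term.subst, Term.code, h]⟩

/-- For a fixed formula `ψ`, the truth value of `ψ[t]` is a primitive recursive property of the
Gödel number of `t`. The formula being fixed, this is an induction on `ψ` without any recursion on
codes. -/
theorem exists_primrec_holds {s : L.Srt} (ψ : Formula L) :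
    ∃ p : ℕ → ℕ → Prop, (PrimrecPred fun x : ℕ × ℕ => p x.1 x.2) ∧
      ∀ m (t : Term L s), p m t.code ↔ ψ.Holds m.testBit (substSort s t) := by
  induction ψ with
  | falsum => exact ⟨fun _ _ => (0 : ℕ) = 1, by fun_prop, fun m t => by simp [Formula.Holds]⟩
  | equal u w =>
    obtain ⟨f, hf, h⟩ := exists_primrec_subst (s := s) u
    obtain ⟨g, hg, h'⟩ := exists_primrec_subst (s := s) w
    refine ⟨fun m n => m.testBit (Nat.pair 1 (Nat.pair (f n) (g n))) = true, by fun_prop, ?_⟩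
    intro m t
    simp only [Formula.Holds, Formula.code, h, h']
  | rel r us =>
    choose f hf h using fun i => exists_primrec_subst (s := s) (us i)
    have hl : Primrec fun n => List.ofFn fun i => f i n := Primrec.list_ofFn hf
    have he : Primrec fun n => encode (List.ofFn fun i => f i n) := Primrec.encode.comp hl
    refine ⟨fun m n => m.testBit (Nat.pair 2 (Nat.pair (encode r)
      (encode (List.ofFn fun i => f i n)))) = true, ?_, ?_⟩
    · have := he.comp (Primrec.snd : Primrec fun x : ℕ × ℕ => x.2)
      fun_prop
    intro m t
    simp only [Formula.Holds, Formula.code, h]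
  | imp φ ψ ih1 ih2 =>
    obtain ⟨p, hp, h⟩ := ih1
    obtain ⟨q, hq, h'⟩ := ih2
    exact ⟨fun m n => p m n → q m n, by fun_prop, fun m t => by simp only [Formula.Holds, h, h']⟩
  | all s n φ ih => exact ⟨fun _ _ => (0 : ℕ) = 1, by fun_prop, fun m t => by simp [Formula.Holds]⟩

theorem getD_argsCode {r : L.Rl} (ts : (i : Fin (L.arity r)) → Term L (L.relSort r i))
    (i : Fin (L.arity r)) :
    ((Denumerable.ofNat (List ℕ) (argsCode ts)).getD i 0) = (ts i).code := by
  simp [argsCode]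

theorem primrec_admissible (hL : L.Acyclic) {Φ : Theory L} (hΦ : Φ.Finite) :
    PrimrecPred fun x : ℕ × ℕ => Admissible Φ x.1 x.2.testBit := by
  have h1 : PrimrecPred fun x : ℕ × ℕ => ∀ s, ∀ t : Term L s, t.vars ⊆ varsBelow L x.1 →
      x.2.testBit (Formula.equal t t).code = true :=
    .forall_finite fun s => primrecPred_forall_term hL s (by fun_prop)
      (fun x n => x.2.testBit (Nat.pair 1 (Nat.pair n n)) = true) (by fun_prop) fun _ _ => Iff.rfl
  have h2 : PrimrecPred fun x : ℕ × ℕ => ∀ s, ∀ t : Term L s, t.vars ⊆ varsBelow L x.1 →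
      ∀ u : Term L s, u.vars ⊆ varsBelow L x.1 →
      x.2.testBit (Formula.equal t u).code = true → x.2.testBit (Formula.equal u t).code = true :=
    .forall_finite fun s => primrecPred_forall_term hL s (by fun_prop)
      (fun x n => ∀ u : Term L s, u.vars ⊆ varsBelow L x.1 →
        x.2.testBit (Nat.pair 1 (Nat.pair n u.code)) = true →
        x.2.testBit (Nat.pair 1 (Nat.pair u.code n)) = true)
      (primrecPred_forall_term hL s (by fun_prop)
        (fun x n => x.1.2.testBit (Nat.pair 1 (Nat.pair x.2 n)) = true →
          x.1.2.testBit (Nat.pair 1 (Nat.pair n x.2)) = true) (by fun_prop) fun _ _ => Iff.rfl)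
      fun _ _ => Iff.rfl
  have h3 : PrimrecPred fun x : ℕ × ℕ => ∀ s, ∀ t : Term L s, t.vars ⊆ varsBelow L x.1 →
      ∀ u : Term L s, u.vars ⊆ varsBelow L x.1 → ∀ w : Term L s, w.vars ⊆ varsBelow L x.1 →
      x.2.testBit (Formula.equal t u).code = true → x.2.testBit (Formula.equal u w).code = true →
      x.2.testBit (Formula.equal t w).code = true :=
    .forall_finite fun s => primrecPred_forall_term hL s (by fun_prop)
      (fun x n => ∀ u : Term L s, u.vars ⊆ varsBelow L x.1 →
        ∀ w : Term L s, w.vars ⊆ varsBelow L x.1 →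
        x.2.testBit (Nat.pair 1 (Nat.pair n u.code)) = true →
        x.2.testBit (Nat.pair 1 (Nat.pair u.code w.code)) = true →
        x.2.testBit (Nat.pair 1 (Nat.pair n w.code)) = true)
      (primrecPred_forall_term hL s (by fun_prop)
        (fun x k => ∀ w : Term L s, w.vars ⊆ varsBelow L x.1.1 →
          x.1.2.testBit (Nat.pair 1 (Nat.pair x.2 k)) = true →
          x.1.2.testBit (Nat.pair 1 (Nat.pair k w.code)) = true →
          x.1.2.testBit (Nat.pair 1 (Nat.pair x.2 w.code)) = true)
        (primrecPred_forall_term hL s (by fun_prop)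
          (fun x k => x.1.1.2.testBit (Nat.pair 1 (Nat.pair x.1.2 x.2)) = true →
            x.1.1.2.testBit (Nat.pair 1 (Nat.pair x.2 k)) = true →
            x.1.1.2.testBit (Nat.pair 1 (Nat.pair x.1.2 k)) = true) (by fun_prop)
          fun _ _ => Iff.rfl) fun _ _ => Iff.rfl) fun _ _ => Iff.rfl
  have h4 : PrimrecPred fun x : ℕ × ℕ => ∀ f, ∀ t : Term L (L.dom f), t.vars ⊆ varsBelow L x.1 →
      ∀ u : Term L (L.dom f), u.vars ⊆ varsBelow L x.1 →
      x.2.testBit (Formula.equal t u).code = true →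
      x.2.testBit (Formula.equal (.app f t) (.app f u)).code = true :=
    .forall_finite fun f => primrecPred_forall_term hL _ (by fun_prop)
      (fun x n => ∀ u : Term L (L.dom f), u.vars ⊆ varsBelow L x.1 →
        x.2.testBit (Nat.pair 1 (Nat.pair n u.code)) = true →
        x.2.testBit (Nat.pair 1 (Nat.pair (Nat.pair 2 (Nat.pair (encode f) n))
          (Nat.pair 2 (Nat.pair (encode f) u.code)))) = true)
      (primrecPred_forall_term hL _ (by fun_prop)
        (fun x n => x.1.2.testBit (Nat.pair 1 (Nat.pair x.2 n)) = true →
          x.1.2.testBit (Nat.pair 1 (Nat.pair (Nat.pair 2 (Nat.pair (encode f) x.2))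
          (Nat.pair 2 (Nat.pair (encode f) n)))) = true) (by fun_prop) fun _ _ => Iff.rfl)
      fun _ _ => Iff.rfl
  have h5 : PrimrecPred fun x : ℕ × ℕ => ∀ r,
      ∀ ts : (i : Fin (L.arity r)) → Term L (L.relSort r i),
      (∀ i, (ts i).vars ⊆ varsBelow L x.1) →
      ∀ us : (i : Fin (L.arity r)) → Term L (L.relSort r i), (∀ i, (us i).vars ⊆ varsBelow L x.1) →
      (∀ i, x.2.testBit (Formula.equal (ts i) (us i)).code = true) →
      x.2.testBit (Formula.rel r ts).code = true → x.2.testBit (Formula.rel r us).code = true := by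
    refine .forall_finite fun r => ?_
    have hget : ∀ i : ℕ, Primrec fun n => (Denumerable.ofNat (List ℕ) n).getD i 0 := fun i =>
      (Primrec.list_getD 0).comp (Primrec.ofNat _) (.const i)
    have hi : PrimrecPred fun x : ((ℕ × ℕ) × ℕ) × ℕ => ∀ i : Fin (L.arity r),
        x.1.1.2.testBit (Nat.pair 1 (Nat.pair ((Denumerable.ofNat (List ℕ) x.1.2).getD i 0)
          ((Denumerable.ofNat (List ℕ) x.2).getD i 0))) = true := by
      refine .forall_finite fun i => ?_
      have ha := (hget i).comp (Primrec.snd.comp Primrec.fst : Primrec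
        fun x : ((ℕ × ℕ) × ℕ) × ℕ => x.1.2)
      have hb := (hget i).comp (Primrec.snd : Primrec fun x : ((ℕ × ℕ) × ℕ) × ℕ => x.2)
      fun_prop
    refine primrecPred_forall_args hL r (by fun_prop)
      (fun x n => ∀ us : (i : Fin (L.arity r)) → Term L (L.relSort r i),
        (∀ i, (us i).vars ⊆ varsBelow L x.1) →
        (∀ i : Fin (L.arity r), x.2.testBit (Nat.pair 1 (Nat.pair
          ((Denumerable.ofNat (List ℕ) n).getD i 0) (us i).code)) = true) →
        x.2.testBit (Nat.pair 2 (Nat.pair (encode r) n)) = true →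
        x.2.testBit (Nat.pair 2 (Nat.pair (encode r) (argsCode us))) = true)
      (primrecPred_forall_args hL r (by fun_prop)
        (fun x n => (∀ i : Fin (L.arity r), x.1.2.testBit (Nat.pair 1 (Nat.pair
          ((Denumerable.ofNat (List ℕ) x.2).getD i 0)
          ((Denumerable.ofNat (List ℕ) n).getD i 0))) = true) →
          x.1.2.testBit (Nat.pair 2 (Nat.pair (encode r) x.2)) = true →
          x.1.2.testBit (Nat.pair 2 (Nat.pair (encode r) n)) = true) (by fun_prop) ?_) ?_
    · intro x us
      simp only [getD_argsCode]
    · intro x ts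
      simp only [getD_argsCode]
      rfl
  have h6 : PrimrecPred fun x : ℕ × ℕ => ∀ φ : Φ, ∀ s n ψ, φ.1.1 = .all s n ψ →
      ∀ t : Term L s, t.vars ⊆ varsBelow L x.1 → ψ.Holds x.2.testBit (substSort s t) := by
    have := hΦ.to_subtype
    refine .forall_finite fun φ => ?_
    by_cases h : ∃ s n ψ, φ.1.1 = .all s n ψ
    · obtain ⟨s, n, ψ, e⟩ := h
      obtain ⟨p, hp, hpψ⟩ := exists_primrec_holds (s := s) ψ
      have := primrecPred_forall_term hL s (α := ℕ × ℕ) (N := fun x => x.1) (by fun_prop)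
        (fun x n => p x.2 n)
        (hp.comp ((Primrec.snd.comp Primrec.fst).pair Primrec.snd)) fun x t => hpψ x.2 t
      refine this.of_eq fun x => ⟨fun H s' n' ψ' e' => ?_, fun H => H s n ψ e⟩
      rw [e] at e'
      cases e'
      exact H
    · refine (PrimrecPred.eq_comp (.const 0) (.const 0)).of_eq fun x => iff_of_true rfl ?_
      exact fun s n ψ e => (h ⟨s, n, ψ, e⟩).elim
  refine (h1.and (h2.and (h3.and (h4.and (h5.and h6))))).of_eq fun x => ⟨fun H => ?_, fun H => ?_⟩
  · exact ⟨H.1, H.2.1, H.2.2.1, H.2.2.2.1, H.2.2.2.2.1, fun φ hφ => H.2.2.2.2.2 ⟨φ, hφ⟩⟩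
  · exact ⟨H.refl, H.symm, H.trans, H.app, H.rel, fun φ => H.ax φ.1 φ.2⟩

/-! ### Satisfiability -/

theorem Term.pair_le_code {s : L.Srt} (t : Term L s) {x : L.Srt × ℕ} (hx : x ∈ t.vars) :
    Nat.pair (encode x.1) x.2 ≤ t.code := by
  induction t with
  | var s n =>
    cases hx
    exact Nat.right_le_pair _ _
  | cst c => exact hx.elim
  | app f t ih => exact (ih hx).trans ((Nat.right_le_pair _ _).trans (Nat.right_le_pair _ _))

theorem Formula.IsQF.pair_le_code {φ : Formula L} (hφ : φ.IsQF) {x : L.Srt × ℕ}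
    (hx : x ∈ φ.freeVars) : Nat.pair (encode x.1) x.2 ≤ φ.code := by
  induction φ with
  | falsum => exact hx.elim
  | equal t u =>
    refine le_trans ?_ (Nat.right_le_pair _ _)
    rcases hx with hx | hx
    · exact (t.pair_le_code hx).trans (Nat.left_le_pair _ _)
    · exact (u.pair_le_code hx).trans (Nat.right_le_pair _ _)
  | rel r ts =>
    obtain ⟨i, hi⟩ := Set.mem_iUnion.1 hx
    refine le_trans (((ts i).pair_le_code hi).trans ?_)
      ((Nat.right_le_pair _ _).trans (Nat.right_le_pair _ _))
    have hl : ∀ (l : List ℕ) (a : ℕ), a ∈ l → a ≤ encode l := by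
      intro l a ha
      induction l with
      | nil => simp at ha
      | cons b l ih =>
        rw [encode_list_cons]
        refine le_trans ?_ (Nat.le_succ _)
        rcases List.mem_cons.1 ha with rfl | ha
        · exact Nat.left_le_pair _ _
        · exact (ih ha).trans (Nat.right_le_pair _ _)
    exact hl _ _ ((List.mem_ofFn' _ _).2 ⟨i, rfl⟩)
  | imp φ ψ ih1 ih2 =>
    refine le_trans ?_ (Nat.right_le_pair _ _)
    rcases hx with hx | hx
    · exact (ih1 hφ.1 hx).trans (Nat.left_le_pair _ _)
    · exact (ih2 hφ.2 hx).trans (Nat.right_le_pair _ _)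
  | all s n φ ih => exact hφ.elim

/-- There is a number `K` such that the variables below `c + K` include one variable of each sort
and all variables of the quantifier-free formula with Gödel number `c`. -/
theorem exists_level (L : DBSignature) : ∃ K : ℕ, (∀ c s, (s, 0) ∈ varsBelow L (c + K)) ∧
    ∀ φ : Formula L, φ.IsQF → φ.freeVars ⊆ varsBelow L (φ.code + K) := by
  obtain ⟨K, hK⟩ := (Set.finite_range fun s : L.Srt => Nat.pair (encode s) 0).bddAbove
  -- the extra one makes the bound strict for the variables of the formula
  refine ⟨K + 1, fun c s => ?_, fun φ hφ x hx => ?_⟩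
  · exact Nat.lt_of_lt_of_le (Nat.lt_succ_of_le (hK ⟨s, rfl⟩)) (Nat.le_add_left _ _)
  · exact Nat.lt_of_le_of_lt (hφ.pair_le_code hx) (by omega)

/-- Truth of atomic formulas in a structure is given by the bits of a natural number. -/
theorem exists_mask {A : ℕ} {V : Set (L.Srt × ℕ)}
    (hA : ∀ α : Formula L, α.IsAtomic → α.freeVars ⊆ V → α.code < A) {M : Struct L}
    (v : Assignment M) : ∃ m < 2 ^ A, Agrees V m.testBit v := by
  classical
  let f : Fin A → Bool := fun i => decide (∃ α : Formula L, α.code = i ∧ α.Realize M v)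
  refine ⟨Nat.ofBits f, Nat.ofBits_lt_two_pow f, fun α hα hV => ?_⟩
  rw [Nat.testBit_ofBits_lt f _ (hA α hα hV), decide_eq_true_iff]
  exact ⟨fun ⟨β, e, h⟩ => Formula.code_injective e ▸ h, fun h => ⟨α, rfl, h⟩⟩

/-- A quantifier-free formula is satisfiable iff one of finitely many valuations is admissible and
makes it true. -/
theorem satisfiable_iff_exists_mask {Φ : Theory L} (hΦ : ∀ φ ∈ Φ, φ.1.IsUniversalOneVar) {A N : ℕ}
    (h0 : ∀ s, (s, 0) ∈ varsBelow L N)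
    (hA : ∀ α : Formula L, α.IsAtomic → α.freeVars ⊆ varsBelow L N → α.code < A)
    {φ : Formula L} (hφ : φ.IsQF) (hN : φ.freeVars ⊆ varsBelow L N) :
    Φ.Satisfiable φ ↔
      ∃ m < 2 ^ A, Admissible Φ N m.testBit ∧ evalCode m.testBit φ.code = true := by
  constructor
  · rintro ⟨M, v, hM, h⟩
    obtain ⟨m, hm, ha⟩ := exists_mask hA v
    exact ⟨m, hm, ha.admissible hΦ h0 hM, (ha.evalCode_iff hφ hN).2 h⟩
  · rintro ⟨m, -, hm, h⟩
    obtain ⟨M, v, hM, ha⟩ := hm.exists_agrees hΦ h0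
    exact ⟨M, v, hM, (ha.evalCode_iff hφ hN).1 h⟩

theorem decidableConstraintSat_of_oneVar (hL : L.Acyclic) {Φ : Theory L} (hfin : Φ.Finite)
    (hΦ : ∀ φ ∈ Φ, φ.1.IsUniversalOneVar) : Φ.DecidableConstraintSat := by
  classical
  obtain ⟨A, hA, hAt⟩ := exists_atom_bound hL
  obtain ⟨K, h0, hK⟩ := exists_level L
  have hadm := primrec_admissible hL hfin
  have h : PrimrecPred fun c : ℕ => ∃ m < 2 ^ A (c + K),
      Admissible Φ (c + K) m.testBit ∧ evalCode m.testBit c = true := by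
    have h1 : PrimrecPred fun x : ℕ × ℕ => Admissible Φ (x.1 + K) x.2.testBit :=
      hadm.comp (f := fun x : ℕ × ℕ => (x.1 + K, x.2)) (by fun_prop)
    fun_prop
  refine ⟨_, h.decide.to_comp, fun φ hφ => ?_⟩
  rw [decide_eq_true_iff, satisfiable_iff_exists_mask hΦ (h0 _) (hAt _) hφ (hK φ hφ)]

/-! ### Elimination of one quantifier -/

/-- A property of valuations which depends on finitely many atomic formulas is expressed by a
quantifier-free formula. -/
theorem exists_isQF_of_dependsOn (as : List (Formula L)) (has : ∀ α ∈ as, α.IsAtomic)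
    (C : (ℕ → Bool) → Prop)
    (hC : ∀ P Q : ℕ → Bool, (∀ α ∈ as, P α.code = Q α.code) → (C P ↔ C Q)) :
    ∃ ψ : Formula L, ψ.IsQF ∧ (∀ x ∈ ψ.freeVars, ∃ α ∈ as, x ∈ α.freeVars) ∧
      ∀ P, evalCode P ψ.code = true ↔ C P := by
  induction as generalizing C with
  | nil =>
    by_cases h : C fun _ => false
    · refine ⟨.imp .falsum .falsum, ⟨trivial, trivial⟩, fun x hx => (or_self_iff.1 hx).elim,
        fun P => ?_⟩
      rw [hC P (fun _ => false) (by simp)]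
      simpa using h
    · refine ⟨.falsum, trivial, fun x hx => hx.elim, fun P => ?_⟩
      rw [hC P (fun _ => false) (by simp)]
      simpa using h
  | cons α as ih =>
    have hα := has α (by simp)
    -- Shannon expansion along `α`
    have hb : ∀ b : Bool, ∃ ψ : Formula L, ψ.IsQF ∧
        (∀ x ∈ ψ.freeVars, ∃ α ∈ as, x ∈ α.freeVars) ∧
        ∀ P, evalCode P ψ.code = true ↔ C (Function.update P α.code b) := by
      intro b
      refine ih (fun β hβ => has β (by simp [hβ])) (fun P => C (Function.update P α.code b)) ?_
      intro P Q h
      refine hC _ _ fun β hβ => ?_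
      by_cases e : β.code = α.code
      · simp [e]
      · rcases List.mem_cons.1 hβ with rfl | hβ
        · exact (e rfl).elim
        · simp [e, h β hβ]
    obtain ⟨ψ, hψ, hv, h1⟩ := hb true
    obtain ⟨χ, hχ, hv', h2⟩ := hb false
    have hqf : α.IsQF := by cases hα <;> trivial
    refine ⟨((α.imp ψ).imp ((α.neg.imp χ).imp .falsum)).imp .falsum,
      ⟨⟨⟨hqf, hψ⟩, ⟨⟨hqf, trivial⟩, hχ⟩, trivial⟩, trivial⟩, ?_, fun P => ?_⟩
    · intro x hx
      simp only [Formula.freeVars, Formula.neg, Set.mem_union, Set.mem_empty_iff_false,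
        or_false] at hx
      rcases hx with (hx | hx) | hx | hx
      · exact ⟨α, by simp, hx⟩
      · obtain ⟨β, hβ, h⟩ := hv x hx
        exact ⟨β, by simp [hβ], h⟩
      · exact ⟨α, by simp, hx⟩
      · obtain ⟨β, hβ, h⟩ := hv' x hx
        exact ⟨β, by simp [hβ], h⟩
    · have hP : Function.update P α.code (P α.code) = P := Function.update_eq_self _ _
      have h1 := h1 P
      have h2 := h2 P
      simp only [Formula.neg, evalCode_imp, evalCode_falsum, evalCode_atomic P hα]
      cases hb : P α.code
      · rw [hb] at hP
        rw [hP] at h2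
        simpa using h2
      · rw [hb] at hP
        rw [hP] at h1
        simpa using h1

/-- The Gödel numbers below `N`, other than `x`, of the variables of the quantifier-free formula
with Gödel number `c`: those which cannot be left out of the list of permitted variables. -/
noncomputable def otherVars (L : DBSignature) (N c x : ℕ) : List ℕ :=
  (List.range N).filter fun y => decide (y ≠ x ∧
    ¬ isQFCode L ((List.range N).filter fun z => decide (z ≠ y)) c = true)

theorem varsIn_otherVars {N : ℕ} {φ : Formula L} (hφ : φ.IsQF) (hN : φ.freeVars ⊆ varsBelow L N)
    (s : L.Srt) (n : ℕ) :
    varsIn L (otherVars L N φ.code (Nat.pair (encode s) n)) = φ.freeVars \ {(s, n)} := by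
  have hinj : ∀ x y : L.Srt × ℕ,
      Nat.pair (encode x.1) x.2 = Nat.pair (encode y.1) y.2 → x = y := by
    intro x y h
    obtain ⟨h1, h2⟩ := Nat.pair_eq_pair.1 h
    exact Prod.ext (encode_injective h1) h2
  ext x
  simp only [varsIn, otherVars, Set.mem_ofPred_eq, List.mem_filter, List.mem_range,
    decide_eq_true_eq, Set.mem_sdiff, Set.mem_singleton_iff, isQFCode_iff]
  constructor
  · rintro ⟨hx, hne, h⟩
    refine ⟨?_, fun e => hne (by rw [e])⟩
    by_contra hv
    refine h ⟨φ, hφ, fun y hy => ?_, rfl⟩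
    exact ⟨hN hy, fun e => hv (hinj y x e ▸ hy)⟩
  · rintro ⟨hx, hne⟩
    refine ⟨hN hx, fun e => hne (hinj x (s, n) e), ?_⟩
    rintro ⟨ψ, -, hv, e⟩
    obtain rfl := Formula.code_injective e
    simpa using hv hx

@[fun_prop] theorem primrec_otherVars {α : Type} [Primcodable α] {N c x : α → ℕ} (hN : Primrec N)
    (hc : Primrec c) (hx : Primrec x) : Primrec fun a => otherVars L (N a) (c a) (x a) := by
  unfold otherVars
  refine Primrec.filter_comp (by fun_prop) ?_
  have : Primrec fun y : α × ℕ => (List.range (N y.1)).filter fun z => decide (z ≠ y.2) :=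
    Primrec.filter_comp (by fun_prop) (by fun_prop)
  fun_prop

/-- Specification of the result `d` of eliminating the universal quantifier over the variable `x`
from the quantifier-free formula with Gödel number `c`: it is a quantifier-free formula in the
other variables, which is true under an admissible valuation iff the given formula is true under
all admissible valuations with the same values on the atomic formulas in these variables. -/
def IsElimination (Φ : Theory L) (N A c x d : ℕ) : Prop :=
  isQFCode L (otherVars L N c x) d = true ∧ ∀ m < 2 ^ A, Admissible Φ N m.testBit →
    (evalCode m.testBit d = true ↔ ∀ m' < 2 ^ A, Admissible Φ N m'.testBit →
      (∀ a < A, IsAtomCode L (otherVars L N c x) a → m.testBit a = m'.testBit a) →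
      evalCode m'.testBit c = true)

/-- Eliminations exist since the condition on the valuation depends only on the finitely many atomic
formulas in the other variables. -/
theorem exists_isElimination (Φ : Theory L) (N A c x : ℕ) : ∃ d, IsElimination Φ N A c x d := by
  have hfin : {α : Formula L | α.IsAtomic ∧ α.freeVars ⊆ varsIn L (otherVars L N c x) ∧
      α.code < A}.Finite :=
    ((Set.finite_lt_nat A).preimage Formula.code_injective.injOn).subset fun α h => h.2.2
  have hmem : ∀ α : Formula L, α ∈ hfin.toFinset.toList ↔
      α.IsAtomic ∧ α.freeVars ⊆ varsIn L (otherVars L N c x) ∧ α.code < A := by simp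
  let C : (ℕ → Bool) → Prop := fun P => ∀ m' < 2 ^ A, Admissible Φ N m'.testBit →
    (∀ a < A, IsAtomCode L (otherVars L N c x) a → P a = m'.testBit a) →
    evalCode m'.testBit c = true
  have hC : ∀ P Q : ℕ → Bool, (∀ α ∈ hfin.toFinset.toList, P α.code = Q α.code) →
      (C P ↔ C Q) := by
    intro P Q hPQ
    have : ∀ a < A, IsAtomCode L (otherVars L N c x) a → P a = Q a := by
      intro a ha hat
      obtain ⟨α, hα, hv, rfl⟩ := isAtomCode_iff.1 hat
      exact hPQ α ((hmem α).2 ⟨hα, hv, ha⟩)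
    refine forall_congr' fun m' => forall_congr' fun _ => forall_congr' fun _ =>
      imp_congr_left ⟨fun H a ha hat => ?_, fun H a ha hat => ?_⟩
    · rw [← this a ha hat, H a ha hat]
    · rw [this a ha hat, H a ha hat]
  obtain ⟨ψ, hψ, hv, h⟩ := exists_isQF_of_dependsOn hfin.toFinset.toList
    (fun α hα => ((hmem α).1 hα).1) C hC
  refine ⟨ψ.code, (isQFCode_iff _).2 ⟨ψ, hψ, fun y hy => ?_, rfl⟩, fun m _ _ => h _⟩
  obtain ⟨α, hα, hy⟩ := hv y hy
  exact ((hmem α).1 hα).2.1 hy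

/-- The formula obtained by eliminating a quantifier is correct in rich models: a valuation of the
atomic formulas in the remaining variables which extends to an admissible one falsifying `χ` is
realized by a counterexample in the model itself. -/
theorem IsElimination.realize_iff {Φ : Theory L} (hΦ : ∀ φ ∈ Φ, φ.1.IsUniversalOneVar) {A N : ℕ}
    (h0 : ∀ s, (s, 0) ∈ varsBelow L N)
    (hA : ∀ α : Formula L, α.IsAtomic → α.freeVars ⊆ varsBelow L N → α.code < A)
    {χ : Formula L} (hχ : χ.IsQF) (hN : χ.freeVars ⊆ varsBelow L N) (s : L.Srt) (n : ℕ)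
    {ψ : Formula L} (hψ : ψ.IsQF) (hv : ψ.freeVars ⊆ χ.freeVars \ {(s, n)})
    (h : IsElimination Φ N A χ.code (Nat.pair (encode s) n) ψ.code) {M : Struct L}
    (hM : IsRich Φ M) (v : Assignment M) :
    (Formula.all s n χ).Realize M v ↔ ψ.Realize M v := by
  have hV : χ.freeVars \ {(s, n)} ⊆ varsBelow L N := Set.sdiff_subset.trans hN
  obtain ⟨m, hm, ha⟩ := exists_mask hA v
  rw [← ha.evalCode_iff hψ (hv.trans hV), h.2 m hm (ha.admissible hΦ h0 hM.1)]
  constructor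
  · intro hall m' _ had hagree
    by_contra hne
    obtain ⟨M', w, hM', ha'⟩ := had.exists_agrees hΦ h0
    have hχ' : ¬ χ.Realize M' w := fun H => hne ((ha'.evalCode_iff hχ hN).2 H)
    have hsame : SameType v w (χ.neg.freeVars \ {(s, n)}) := by
      intro α hα hαV
      have hαV : α.freeVars ⊆ χ.freeVars \ {(s, n)} := by
        simpa [Formula.neg, Formula.freeVars] using hαV
      rw [← ha α hα (hαV.trans hV), ← ha' α hα (hαV.trans hV),
        hagree _ (hA α hα (hαV.trans hV)) (isAtomCode_iff.2
          ⟨α, hα, by rwa [varsIn_otherVars hχ hN], rfl⟩)]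
    -- richness turns the solution of `¬ χ` in `M'` into one in `M`
    obtain ⟨a, hna⟩ := hM.2 χ.neg ⟨hχ, trivial⟩ s n v ⟨M', w, hM', hsame, hχ'⟩
    exact hna (hall a)
  · intro hall a
    obtain ⟨m', hm', ha'⟩ := exists_mask hA (v.update s n a)
    rw [← ha'.evalCode_iff hχ hN]
    refine hall m' hm' (ha'.admissible hΦ h0 hM.1) fun i _ hi => ?_
    obtain ⟨α, hα, hαV, rfl⟩ := isAtomCode_iff.1 hi
    rw [varsIn_otherVars hχ hN] at hαV
    rw [Bool.eq_iff_iff, ha α hα (hαV.trans hV), ha' α hα (hαV.trans hV)]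
    exact Formula.realize_congr α fun x hx =>
      (Assignment.update_of_ne _ _ _ _ (hαV hx).2).symm

theorem exists_computable_elimination (hL : L.Acyclic) {Φ : Theory L} (hfin : Φ.Finite)
    (hΦ : ∀ φ ∈ Φ, φ.1.IsUniversalOneVar) : ∃ e : ℕ × ℕ → ℕ, Computable e ∧
      ∀ χ : Formula L, χ.IsQF → ∀ s n, ∃ ψ : Formula L,
        ψ.code = e (χ.code, Nat.pair (encode s) n) ∧ ψ.IsQF ∧ ψ.freeVars ⊆ χ.freeVars \ {(s, n)} ∧
        ∀ (M : Struct L) (v : Assignment M), IsRich Φ M →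
          ((Formula.all s n χ).Realize M v ↔ ψ.Realize M v) := by
  obtain ⟨A, hA, hAt⟩ := exists_atom_bound hL
  obtain ⟨K, h0, hK⟩ := exists_level L
  have hadm := primrec_admissible hL hfin
  have hp : PrimrecPred fun y : (ℕ × ℕ) × ℕ =>
      IsElimination Φ (y.1.1 + K) (A (y.1.1 + K)) y.1.1 y.1.2 y.2 := by
    have h1 : PrimrecPred fun y : ((ℕ × ℕ) × ℕ) × ℕ =>
        Admissible Φ (y.1.1.1 + K) y.2.testBit :=
      hadm.comp (f := fun y : ((ℕ × ℕ) × ℕ) × ℕ => (y.1.1.1 + K, y.2)) (by fun_prop)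
    have h2 : PrimrecPred fun y : (((ℕ × ℕ) × ℕ) × ℕ) × ℕ =>
        Admissible Φ (y.1.1.1.1 + K) y.2.testBit :=
      hadm.comp (f := fun y : (((ℕ × ℕ) × ℕ) × ℕ) × ℕ => (y.1.1.1.1 + K, y.2)) (by fun_prop)
    unfold IsElimination
    fun_prop
  obtain ⟨e, he, hspec⟩ := PrimrecPred.exists_computable
    (p := fun (y : ℕ × ℕ) d => IsElimination Φ (y.1 + K) (A (y.1 + K)) y.1 y.2 d) hp
    fun y => exists_isElimination Φ _ _ _ _
  refine ⟨e, he, fun χ hχ s n => ?_⟩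
  have h := hspec (χ.code, Nat.pair (encode s) n)
  obtain ⟨ψ, hψ, hv, e'⟩ := (isQFCode_iff _).1 h.1
  rw [varsIn_otherVars hχ (hK χ hχ)] at hv
  refine ⟨ψ, e', hψ, hv, fun M v hM => ?_⟩
  rw [← e'] at h
  exact h.realize_iff hΦ (h0 _) (hAt _) hχ (hK χ hχ) s n hψ hv hM v

/-! ### The model completion -/

/-- Quantifiers are eliminated by recursion on formulas, the innermost ones first. -/
theorem exists_computable_quantifierElimination (hL : L.Acyclic) {Φ : Theory L} (hfin : Φ.Finite)
    (hΦ : ∀ φ ∈ Φ, φ.1.IsUniversalOneVar) : ∃ q : ℕ → ℕ, Computable q ∧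
      ∀ φ : Formula L, ∃ ψ : Formula L, ψ.code = q φ.code ∧ ψ.IsQF ∧ ψ.freeVars ⊆ φ.freeVars ∧
        ∀ (M : Struct L) (v : Assignment M), IsRich Φ M → (φ.Realize M v ↔ ψ.Realize M v) := by
  obtain ⟨e, he, hspec⟩ := exists_computable_elimination hL hfin hΦ
  let g : ℕ → ℕ → ℕ → ℕ := fun n x y =>
    bif decide (n.unpair.1 = 3) then Nat.pair 3 (Nat.pair x y)
    else bif decide (n.unpair.1 = 4) then e (y, n.unpair.2.unpair.1) else n
  have hg : Computable fun x : ℕ × ℕ × ℕ => g x.1 x.2.1 x.2.2 := by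
    have h3 : Primrec fun x : ℕ × ℕ × ℕ => decide (x.1.unpair.1 = 3) :=
      PrimrecPred.decide (by fun_prop)
    have h4 : Primrec fun x : ℕ × ℕ × ℕ => decide (x.1.unpair.1 = 4) :=
      PrimrecPred.decide (by fun_prop)
    have hi : Primrec fun x : ℕ × ℕ × ℕ => Nat.pair 3 (Nat.pair x.2.1 x.2.2) := by fun_prop
    have ha : Primrec fun x : ℕ × ℕ × ℕ => (x.2.2, x.1.unpair.2.unpair.1) := by fun_prop
    exact Computable.cond h3.to_comp hi.to_comp
      (Computable.cond h4.to_comp (he.comp ha.to_comp) Computable.fst)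
  refine ⟨codeRec id g, computable_codeRec Computable.id hg, fun φ => ?_⟩
  induction φ with
  | falsum =>
    refine ⟨.falsum, ?_, trivial, subset_rfl, fun _ _ _ => Iff.rfl⟩
    rw [codeRec_of_tag_zero _ _ (by simp [Formula.code])]
    rfl
  | equal t u =>
    refine ⟨.equal t u, ?_, trivial, subset_rfl, fun _ _ _ => Iff.rfl⟩
    rw [codeRec_of_tag_ne_zero _ _ (by simp [Formula.code])]
    simp [g, Formula.code]
  | rel r ts =>
    refine ⟨.rel r ts, ?_, trivial, subset_rfl, fun _ _ _ => Iff.rfl⟩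
    rw [codeRec_of_tag_ne_zero _ _ (by simp [Formula.code])]
    simp [g, Formula.code]
  | imp φ ψ ih1 ih2 =>
    obtain ⟨φ', e1, hq1, hv1, h1⟩ := ih1
    obtain ⟨ψ', e2, hq2, hv2, h2⟩ := ih2
    refine ⟨φ'.imp ψ', ?_, ⟨hq1, hq2⟩, Set.union_subset_union hv1 hv2, fun M v hM => ?_⟩
    · rw [codeRec_of_tag_ne_zero _ _ (by simp [Formula.code])]
      simp [g, Formula.code, e1, e2]
    · rw [Formula.Realize, Formula.Realize, h1 M v hM, h2 M v hM]
  | all s n φ ih =>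
    obtain ⟨φ', e1, hq1, hv1, h1⟩ := ih
    obtain ⟨ψ, e2, hq2, hv2, h2⟩ := hspec φ' hq1 s n
    refine ⟨ψ, ?_, hq2, hv2.trans (Set.sdiff_subset_sdiff_left hv1), fun M v hM => ?_⟩
    · rw [codeRec_of_tag_ne_zero _ _ (by simp [Formula.code])]
      simp [g, Formula.code, e2, e1]
    · rw [← h2 M v hM]
      exact forall_congr' fun a => h1 M _ hM

/-- The universal closure with respect to a list of variables. -/
def Formula.closure (φ : Formula L) (l : List (L.Srt × ℕ)) : Formula L :=
  l.foldr (fun x ψ => .all x.1 x.2 ψ) φ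

theorem Formula.freeVars_closure (φ : Formula L) (l : List (L.Srt × ℕ)) :
    (φ.closure l).freeVars = {x ∈ φ.freeVars | x ∉ l} := by
  induction l with
  | nil => simp [closure]
  | cons y l ih =>
    change (φ.closure l).freeVars \ {(y.1, y.2)} = _
    rw [ih]
    ext x
    simp only [Set.mem_sdiff, Set.mem_ofPred_eq, Set.mem_singleton_iff, List.mem_cons]
    tauto

theorem Formula.realize_closure (φ : Formula L) (l : List (L.Srt × ℕ)) (M : Struct L) :
    (∀ v : Assignment M, (φ.closure l).Realize M v) ↔ ∀ v : Assignment M, φ.Realize M v := by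
  induction l with
  | nil => rfl
  | cons y l ih =>
    rw [← ih]
    refine ⟨fun h v => ?_, fun h v a => h _⟩
    have := h v (v y.1 y.2)
    rwa [Assignment.update_self] at this

/-- The universal closure of a formula is a sentence which is true in a structure iff the formula is
true there under all assignments. -/
theorem Formula.exists_sentence (φ : Formula L) : ∃ σ : Sentence L, ∀ M : Struct L,
    (∀ v : Assignment M, σ.1.Realize M v) ↔ ∀ v : Assignment M, φ.Realize M v := by
  refine ⟨⟨φ.closure φ.freeVars_finite.toFinset.toList, ?_⟩, fun M => φ.realize_closure _ M⟩
  rw [Formula.freeVars_closure]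
  ext x
  simp

theorem Formula.IsConstraint.isQF {φ : Formula L} (h : φ.IsConstraint) : φ.IsQF := by
  obtain ⟨l, hl, rfl⟩ := h
  have hat : ∀ {ψ : Formula L}, ψ.IsAtomic → ψ.IsQF := fun h => by cases h <;> trivial
  induction l with
  | nil => exact ⟨trivial, trivial⟩
  | cons ψ l ih =>
    refine ⟨⟨?_, ih fun χ hχ => hl χ (by simp [hχ]), trivial⟩, trivial⟩
    rcases hl ψ (by simp) with h | ⟨χ, h, rfl⟩
    · exact hat h
    · exact ⟨hat h, trivial⟩

/-- The sentences which are true in all rich models. -/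
def richTheory (Φ : Theory L) : Theory L :=
  {σ | ∀ M : Struct L, IsRich Φ M → ∀ v : Assignment M, σ.1.Realize M v}

/-- Equivalences which hold in all rich models hold in all models of their theory. -/
theorem equivalent_richTheory {Φ : Theory L} {φ ψ : Formula L}
    (h : ∀ (M : Struct L) (v : Assignment M), IsRich Φ M → (φ.Realize M v ↔ ψ.Realize M v)) :
    (richTheory Φ).Equivalent φ ψ := by
  intro M v hM
  obtain ⟨σ, hσ⟩ := (φ.imp ψ).exists_sentence
  obtain ⟨τ, hτ⟩ := (ψ.imp φ).exists_sentence
  have h1 : σ ∈ richTheory Φ := fun N hN => (hσ N).2 fun w => (h N w hN).1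
  have h2 : τ ∈ richTheory Φ := fun N hN => (hτ N).2 fun w => (h N w hN).2
  exact ⟨(hσ M).1 (hM σ h1) v, (hτ M).1 (hM τ h2) v⟩

end DBSignature

theorem mainTheorem3 (L : DBSignature) (T : DBSignature.Theory L)
    (hDB : T.IsDBTheory) (hT : T.IsFinitelyOneVarAxiomatized) (hL : L.Acyclic) :
    T.DecidableConstraintSat ∧ ∃ T' : DBSignature.Theory L, T.IsModelCompletion T' := by
  open DBSignature in
  obtain ⟨Φ, hfin, hΦ, hTΦ⟩ := hT
  have hsat : ∀ φ, T.Satisfiable φ ↔ Φ.Satisfiable φ := fun φ => by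
    simp only [Theory.Satisfiable, hTΦ]
  refine ⟨?_, richTheory Φ, fun σ hσ M hM => (hTΦ M).2 hM.1 σ hσ, fun φ hφ h => ?_, ?_⟩
  · obtain ⟨f, hf, h⟩ := decidableConstraintSat_of_oneVar hL hfin hΦ
    exact ⟨f, hf, fun φ hφ => by rw [h φ hφ, hsat]⟩
  · obtain ⟨M, v, hM, hv⟩ := (hsat φ).1 h
    obtain ⟨M', e, hM'⟩ := exists_emb_isRich hΦ hM
    exact ⟨M', e.assign v, fun σ hσ => hσ M' hM', (e.realize v hφ.isQF).2 hv⟩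
  · obtain ⟨q, hq, h⟩ := exists_computable_quantifierElimination hL hfin hΦ
    refine ⟨q, hq, fun φ => ?_⟩
    obtain ⟨ψ, e, hψ, hv, h⟩ := h φ
    exact ⟨ψ, e, hψ, hv, equivalent_richTheory h⟩
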